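/- Let $X$ be a flag, simply connected simplicial complex. A loop in $X$ is a subcomplex that is a triangulated circle. A filling diagram for a loop $\gamma$ is a simplicial map $f : D \to X$, where $D$ is a triangulated $2$-disc and $f$ maps $\partial D$ isomorphically onto $\gamma$; it is minimal if $D$ has the least possible number of triangles among all filling diagrams for $\gamma$. The complex $X$ is called $6$-uniform if, for every loop $\gamma$ in $X$ and every minimal filling diagram $(D,f)$ for $\gamma$, every interior vertex of $D$ has exactly $6$ neighbours in $D$. For a vertex $v$ of $D$ and an integer $n \ge 0$, the sphere $S_n^6$ of radius $n$ centered at $v$ is the set of edges of $D$ both of whose endpoints are at distance $n$ from $v$ (in the $1$-skeleton of $D$). Its length $|S_n^6|$ is the number of its edges. Its area $A_n^6$ is the number of triangles of $D$ inside it, i.e. of those all of whose vertices are at distance at most $n$ from $v$. **Theorem.** Let $X$ be a $6$-uniform simplicial complex, $\gamma$ a loop in $X$, $(D,f)$ a minimal filling diagram for $\gamma$, $v$ a vertex of $D$ and $n \ge 0$ such that the sphere of radius $n$ centered at $v$ lies inside $D$, in the sense that every vertex of $D$ at distance less than $n$ from $v$ (including $v$ itself if $n\ge 1$) is an interior vertex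 of $D$. Then $$|S_n^6| = 6n \qquad\text{and}\qquad A_n^6 = \frac{|S_n^6|^2}{6}.$$ -/

import Mathlib

/-!
Simplicial complexes are Mathlib's abstract simplicial complexes: `AbstractSimplicialComplex V` when
every element of `V` is a vertex, and `PreAbstractSimplicialComplex V` for subcomplexes.
-/

namespace UniformComplex

open Classical in
/-- The `1`-skeleton, as a simple graph.  Its graph distance `(oneSkeleton K).dist` is the metric on
the `0`-skeleton: the number of edges in a shortest path of the `1`-skeleton. -/
def oneSkeleton {V : Type*} (K : AbstractSimplicialComplex V) : SimpleGraph V where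
  Adj u v := u ≠ v ∧ {u, v} ∈ K.faces
  symm := ⟨fun u v h => ⟨h.1.symm, by rw [Finset.pair_comm]; exact h.2⟩⟩
  loopless := ⟨fun _ h => h.1 rfl⟩

/-- A complex is flag if every nonempty finite set of pairwise adjacent vertices is a simplex. -/
def IsFlag {V : Type*} (K : AbstractSimplicialComplex V) : Prop :=
  ∀ s : Finset V, s.Nonempty → (∀ u ∈ s, ∀ v ∈ s, u ≠ v → (oneSkeleton K).Adj u v) → s ∈ K.faces

open Classical in
/-- Homotopy (with fixed ends) of edge paths in a simplicial complex: the congruence generated by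
deleting a backtrack `u, v, u` and by replacing two sides `u, v, w` of a triangle of `K` by the
third side `u, w`. -/
inductive PathHomotopic {V : Type*} (K : AbstractSimplicialComplex V) :
    ∀ {u v : V}, (oneSkeleton K).Walk u v → (oneSkeleton K).Walk u v → Prop
  | refl {u v : V} (p : (oneSkeleton K).Walk u v) : PathHomotopic K p p
  | symm {u v : V} {p q : (oneSkeleton K).Walk u v} :
      PathHomotopic K p q → PathHomotopic K q p
  | trans {u v : V} {p q r : (oneSkeleton K).Walk u v} :
      PathHomotopic K p q → PathHomotopic K q r → PathHomotopic K p r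
  | cons {u v w : V} (h : (oneSkeleton K).Adj u v) {p q : (oneSkeleton K).Walk v w} :
      PathHomotopic K p q →
        PathHomotopic K (SimpleGraph.Walk.cons h p) (SimpleGraph.Walk.cons h q)
  | backtrack {u v w : V} (h : (oneSkeleton K).Adj u v) (h' : (oneSkeleton K).Adj v u)
      (p : (oneSkeleton K).Walk u w) :
      PathHomotopic K (SimpleGraph.Walk.cons h (SimpleGraph.Walk.cons h' p)) p
  | triangle {u v w x : V} (huv : (oneSkeleton K).Adj u v) (hvw : (oneSkeleton K).Adj v w)
      (huw : (oneSkeleton K).Adj u w) (hface : {u, v, w} ∈ K.faces)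
      (p : (oneSkeleton K).Walk w x) :
      PathHomotopic K (SimpleGraph.Walk.cons huv (SimpleGraph.Walk.cons hvw p))
        (SimpleGraph.Walk.cons huw p)

/-- A simplicial complex is simply connected if it is nonempty and connected and its edge-path group
(which is the fundamental group of its realization) is trivial. -/
structure IsSimplyConnected {V : Type*} (K : AbstractSimplicialComplex V) : Prop where
  connected : (oneSkeleton K).Connected
  null_homotopic : ∀ (v : V) (p : (oneSkeleton K).Walk v v),
    PathHomotopic K p SimpleGraph.Walk.nil

open Classical in
/-- The link of a vertex: all simplices that do not contain `v` and span a simplex with `v`. -/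
def link {V : Type*} (K : AbstractSimplicialComplex V) (v : V) : PreAbstractSimplicialComplex V where
  faces := {s | s.Nonempty ∧ v ∉ s ∧ insert v s ∈ K.faces}
  isRelLowerSet_faces := by
    intro s hs
    refine ⟨hs.1, fun t hts ht => ⟨ht, fun hv => hs.2.1 (hts hv), ?_⟩⟩
    exact (K.isRelLowerSet_faces hs.2.2).2 (Finset.insert_subset_insert v hts)
      (Finset.insert_nonempty v t)

open Classical in
/-- `L` is a triangulated circle: its simplices are exactly the vertices and the edges of an
`n`-gon, `n ≥ 3`. -/
def IsCircle {V : Type*} (L : PreAbstractSimplicialComplex V) : Prop :=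
  ∃ n : ℕ, 3 ≤ n ∧ ∃ c : ZMod n → V, Function.Injective c ∧
    ∀ s : Finset V, s ∈ L.faces ↔ ∃ i : ZMod n, s = {c i} ∨ s = {c i, c (i + 1)}

open Classical in
/-- `L` is a triangulated closed interval with `n ≥ 1` edges. -/
def IsArc {V : Type*} (L : PreAbstractSimplicialComplex V) : Prop :=
  ∃ n : ℕ, 1 ≤ n ∧ ∃ c : Fin (n + 1) → V, Function.Injective c ∧
    ∀ s : Finset V, s ∈ L.faces ↔
      (∃ i : Fin (n + 1), s = {c i}) ∨ (∃ i : Fin n, s = {c i.castSucc, c i.succ})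

/-- `D` is a triangulated `2`-disc: a finite triangulated surface (all vertex links are circles or
arcs) which is simply connected and has nonempty boundary. -/
structure IsDisc {W : Type*} (D : AbstractSimplicialComplex W) : Prop where
  finite : Finite W
  link_circle_or_arc : ∀ v : W, IsCircle (link D v) ∨ IsArc (link D v)
  exists_arc : ∃ v : W, IsArc (link D v)
  simplyConnected : IsSimplyConnected D

/-- The set of triangles (`2`-simplices). -/
def triangles {W : Type*} (D : AbstractSimplicialComplex W) : Set (Finset W) :=
  {s | s ∈ D.faces ∧ s.card = 3}

/-- The boundary of a triangulated surface: the subcomplex generated by the edges that lie in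
exactly one triangle. -/
def boundary {W : Type*} (D : AbstractSimplicialComplex W) : PreAbstractSimplicialComplex W where
  faces := {s | s.Nonempty ∧ ∃ e ∈ D.faces, e.card = 2 ∧
    {t | t ∈ triangles D ∧ e ⊆ t}.ncard = 1 ∧ s ⊆ e}
  isRelLowerSet_faces := by
    rintro s ⟨hs, e, he, h2, h1, hse⟩
    exact ⟨hs, fun t hts ht => ⟨ht, e, he, h2, h1, hts.trans hse⟩⟩

/-- A vertex is interior if it does not lie on the boundary. -/
def IsInterior {W : Type*} (D : AbstractSimplicialComplex W) (v : W) : Prop :=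
  {v} ∉ (boundary D).faces

/-- A loop (cycle) in `X`: a subcomplex that is a triangulated circle. -/
def IsLoop {V : Type*} (X : AbstractSimplicialComplex V) (γ : PreAbstractSimplicialComplex V) :
    Prop :=
  γ.faces ⊆ X.faces ∧ IsCircle γ

open Classical in
/-- `(D, f)` is a filling diagram for `γ`: `D` is a triangulated disc and `f : D → X` is a simplicial
map whose restriction to the boundary of `D` is an isomorphism onto `γ`. -/
structure IsFillingDiagram {V W : Type*} (X : AbstractSimplicialComplex V)
    (γ : PreAbstractSimplicialComplex V) (D : AbstractSimplicialComplex W) (f : W → V) : Prop where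
  disc : IsDisc D
  simplicial : ∀ s ∈ D.faces, s.image f ∈ X.faces
  injOn_boundary : Set.InjOn f {v | {v} ∈ (boundary D).faces}
  map_boundary : (boundary D).map f = γ

/-- A filling diagram for `γ` is minimal if it has the least possible number of triangles among all
filling diagrams for `γ`.  (Discs are finite, so vertex sets in `Type` give all of them up to
isomorphism.) -/
def IsMinimalFillingDiagram {V : Type*} {W : Type} (X : AbstractSimplicialComplex V)
    (γ : PreAbstractSimplicialComplex V) (D : AbstractSimplicialComplex W) (f : W → V) : Prop :=
  IsFillingDiagram X γ D f ∧
    ∀ (W' : Type) (D' : AbstractSimplicialComplex W') (f' : W' → V),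
      IsFillingDiagram X γ D' f' → (triangles D).ncard ≤ (triangles D').ncard

/-- A flag, simply connected simplicial complex is `t`-uniform, `t ≥ 4`, if in every minimal filling
diagram for a loop of it, every interior vertex has exactly `t` neighbours. -/
structure IsUniform {V : Type*} (t : ℕ) (X : AbstractSimplicialComplex V) : Prop where
  four_le : 4 ≤ t
  flag : IsFlag X
  simplyConnected : IsSimplyConnected X
  neighbours : ∀ γ : PreAbstractSimplicialComplex V, IsLoop X γ →
    ∀ (W : Type) (D : AbstractSimplicialComplex W) (f : W → V), IsMinimalFillingDiagram X γ D f →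
      ∀ v : W, IsInterior D v → ((oneSkeleton D).neighborSet v).ncard = t

/-- The sphere of radius `n` centred at `v`: the set of edges spanned by the vertices at distance
`n` from `v`. -/
def sphere {W : Type*} (D : AbstractSimplicialComplex W) (v : W) (n : ℕ) : Set (Finset W) :=
  {e | e ∈ D.faces ∧ e.card = 2 ∧ ∀ w ∈ e, (oneSkeleton D).dist v w = n}

/-- The length of the sphere: the number of its edges. -/
noncomputable def sphereLength {W : Type*} (D : AbstractSimplicialComplex W) (v : W) (n : ℕ) : ℕ :=
  (sphere D v n).ncard

/-- The area of the sphere: the number of triangles inside it, i.e. of the triangles all of whose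
vertices are at distance at most `n` from `v`. -/
noncomputable def sphereArea {W : Type*} (D : AbstractSimplicialComplex W) (v : W) (n : ℕ) : ℕ :=
  {s | s ∈ triangles D ∧ ∀ w ∈ s, (oneSkeleton D).dist v w ≤ n}.ncard

end UniformComplex

/-! A minimal diagram over a 6-uniform complex is a simply connected triangulated surface whose
interior vertices all have degree 6, so it is locally modelled on the triangular lattice. The proof
develops it into that lattice and counts there.

A chart at a vertex sends its star to lattice triangles and reflects across each edge at the vertex.
Six triangles close up because `e (i+1) = e i - e (i-1)` has period 6 (`hexCycle_add_one_add`); at a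
boundary vertex the link is an interval and nothing has to close up. One triangle determines a
chart, so charts can be transported along edges. Transport respects backtracks and triangles, hence
edge-path homotopy, and simple connectivity makes it independent of the path. The result is a global
map `dev` that is a chart at every vertex (`IsHexSurface.exists_development`). It need not be
injective on all of the disc.

On a ball whose vertices at distance less than `n` are interior, induction on the radius
(`DevelopsBall.succ`) shows that `dev` is a bijection onto the lattice ball preserving distance to
the centre, and edges and triangles also lift back. The sphere and its area thus become those of the
lattice hexagon, which has `6 * n` boundary edges and `6 * n ^ 2` triangles (`ncard_hexSphere`,
`ncard_hexBall`). Finally `6 * n ^ 2 = (6 * n) ^ 2 / 6`. -/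

namespace UniformComplex

/-! ### Geometry of the triangular lattice. -/

/-- The six units of the triangular lattice, in the basis `1, exp (iπ/3)`. -/
def HexUnit (d : ℤ × ℤ) : Prop :=
  d = (1, 0) ∨ d = (0, 1) ∨ d = (-1, 1) ∨ d = (-1, 0) ∨ d = (0, -1) ∨ d = (1, -1)

instance : DecidablePred HexUnit := fun _ => inferInstanceAs (Decidable (_ ∨ _))

/-- Distance to the origin in the triangular lattice. -/
def hexNorm (p : ℤ × ℤ) : ℕ := max (max p.1.natAbs p.2.natAbs) (p.1 + p.2).natAbs

/-- Three pairwise adjacent points of the triangular lattice. -/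
def HexTriangle (p q r : ℤ × ℤ) : Prop := HexUnit (q - p) ∧ HexUnit (r - p) ∧ HexUnit (r - q)

theorem HexUnit.neg {d : ℤ × ℤ} (h : HexUnit d) : HexUnit (-d) := by
  rcases h with rfl | rfl | rfl | rfl | rfl | rfl <;> decide

theorem HexUnit.sub_comm {p q : ℤ × ℤ} (h : HexUnit (q - p)) : HexUnit (p - q) := by
  simpa using h.neg

theorem HexUnit.ne {p q : ℤ × ℤ} (h : HexUnit (q - p)) : p ≠ q := by
  rintro rfl; rw [sub_self] at h; revert h; decide

theorem HexTriangle.swap_left {p q r : ℤ × ℤ} (h : HexTriangle p q r) : HexTriangle q p r :=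
  ⟨h.1.sub_comm, h.2.2, h.2.1⟩

theorem HexTriangle.swap_right {p q r : ℤ × ℤ} (h : HexTriangle p q r) : HexTriangle p r q :=
  ⟨h.2.1, h.1, h.2.2.sub_comm⟩

theorem hexNorm_le_iff {p : ℤ × ℤ} {n : ℕ} : hexNorm p ≤ n ↔
    -n ≤ p.1 ∧ p.1 ≤ n ∧ -n ≤ p.2 ∧ p.2 ≤ n ∧ -n ≤ p.1 + p.2 ∧ p.1 + p.2 ≤ n := by
  simp only [hexNorm, max_le_iff]
  omega

theorem hexNorm_eq_iff {p : ℤ × ℤ} {n : ℕ} : hexNorm p = n ↔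
    (-n ≤ p.1 ∧ p.1 ≤ n ∧ -n ≤ p.2 ∧ p.2 ≤ n ∧ -n ≤ p.1 + p.2 ∧ p.1 + p.2 ≤ n) ∧
      (p.1 = n ∨ p.1 = -n ∨ p.2 = n ∨ p.2 = -n ∨ p.1 + p.2 = n ∨ p.1 + p.2 = -n) := by
  rw [← hexNorm_le_iff]
  simp only [hexNorm]
  omega

theorem hexNorm_le_add_one {p q : ℤ × ℤ} (h : HexUnit (q - p)) : hexNorm q ≤ hexNorm p + 1 := by
  have hp := hexNorm_le_iff.1 (le_refl (hexNorm p))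
  rw [hexNorm_le_iff]
  obtain ⟨d, rfl⟩ : ∃ d, q = p + d := ⟨q - p, by abel⟩
  rw [add_sub_cancel_left] at h
  push_cast
  rcases h with rfl | rfl | rfl | rfl | rfl | rfl <;>
  simp only [Prod.fst_add, Prod.snd_add] <;> omega

theorem hexNorm_eq_zero {p : ℤ × ℤ} (h : hexNorm p = 0) : p = 0 := by
  simp only [hexNorm] at h
  ext <;> simp <;> omega

theorem exists_hexNorm_pred {p : ℤ × ℤ} {k : ℕ} (h : hexNorm p = k + 1) :
    ∃ q, HexUnit (p - q) ∧ hexNorm q = k := by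
  have key : ∃ d, HexUnit d ∧ hexNorm (p - d) = k := by
    obtain ⟨a, b⟩ := p
    rw [hexNorm_eq_iff] at h
    simp only [hexNorm_eq_iff, Prod.fst_sub, Prod.snd_sub]
    push_cast at h
    obtain ⟨h, h'⟩ := h
    -- The signs of the coordinates select a sector, and `d` is a unit pointing outward in it.
    rcases lt_trichotomy a 0 with ha | ha | ha
    · rcases le_or_gt b 0 with hb | hb
      · exact ⟨(-1, 0), by decide, by constructor <;> omega⟩
      · exact ⟨(-1, 1), by decide, by constructor <;> omega⟩
    · rcases le_or_gt b 0 with hb | hb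
      · exact ⟨(0, -1), by decide, by constructor <;> omega⟩
      · exact ⟨(0, 1), by decide, by constructor <;> omega⟩
    · rcases lt_or_ge b 0 with hb | hb
      · exact ⟨(1, -1), by decide, by constructor <;> omega⟩
      · exact ⟨(1, 0), by decide, by constructor <;> omega⟩
  obtain ⟨d, hd, h⟩ := key
  exact ⟨p - d, by rwa [sub_sub_cancel], h⟩

/-- An edge between two points of the hexagon of radius `n` lies on one of its six sides. -/
theorem hexNorm_side {p d : ℤ × ℤ} {n : ℕ} (hd : HexUnit d) (hp : hexNorm p = n)
    (hq : hexNorm (p + d) = n) :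
    (d.1 = 0 ∧ (p.1 = n ∨ p.1 = -n)) ∨ (d.2 = 0 ∧ (p.2 = n ∨ p.2 = -n)) ∨
      (d.1 + d.2 = 0 ∧ (p.1 + p.2 = n ∨ p.1 + p.2 = -n)) := by
  obtain ⟨a, b⟩ := p
  rw [hexNorm_eq_iff] at hp hq
  obtain ⟨hp, hp'⟩ := hp
  obtain ⟨hq, hq'⟩ := hq
  simp only [Prod.fst_add, Prod.snd_add] at *
  rcases hd with rfl | rfl | rfl | rfl | rfl | rfl <;> simp at * <;> omega

/-- An edge of the hexagon of radius `k + 1` spans a triangle with a point at distance `k`. -/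
theorem exists_common_hexNorm_pred {p q : ℤ × ℤ} {k : ℕ} (hpq : HexUnit (q - p))
    (hp : hexNorm p = k + 1) (hq : hexNorm q = k + 1) :
    ∃ r, HexUnit (p - r) ∧ HexUnit (q - r) ∧ hexNorm r = k := by
  obtain ⟨d, rfl⟩ : ∃ d, q = p + d := ⟨q - p, by abel⟩
  rw [add_sub_cancel_left] at hpq
  -- Of the two apexes `p + e` of the edge, the one on the side of the origin is chosen.
  suffices h : ∃ e, HexUnit e ∧ HexUnit (d - e) ∧ hexNorm (p + e) = k by
    obtain ⟨e, he, hde, h⟩ := h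
    exact ⟨p + e, by simpa using he.neg, by simpa using hde, h⟩
  have hs := hexNorm_side hpq hp hq
  obtain ⟨a, b⟩ := p
  rw [hexNorm_eq_iff] at hp hq
  replace hp := hp.1
  replace hq := hq.1
  simp only [Prod.fst_add, Prod.snd_add, Nat.cast_add, Nat.cast_one] at hs hp hq
  rcases hpq with rfl | rfl | rfl | rfl | rfl | rfl
  · rcases (by simpa using hs : b = k + 1 ∨ b = -(k + 1 : ℤ)) with h | h
    · exact ⟨(1, -1), by decide, by decide, hexNorm_eq_iff.2
        (by dsimp only [Prod.mk_add_mk]; omega)⟩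
    · exact ⟨(0, 1), by decide, by decide, hexNorm_eq_iff.2
        (by dsimp only [Prod.mk_add_mk]; omega)⟩
  · rcases (by simpa using hs : a = k + 1 ∨ a = -(k + 1 : ℤ)) with h | h
    · exact ⟨(-1, 1), by decide, by decide, hexNorm_eq_iff.2
        (by dsimp only [Prod.mk_add_mk]; omega)⟩
    · exact ⟨(1, 0), by decide, by decide, hexNorm_eq_iff.2
        (by dsimp only [Prod.mk_add_mk]; omega)⟩
  · rcases (by simpa using hs : a + b = k + 1 ∨ a + b = -(k + 1 : ℤ)) with h | h
    · exact ⟨(-1, 0), by decide, by decide, hexNorm_eq_iff.2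
        (by dsimp only [Prod.mk_add_mk]; omega)⟩
    · exact ⟨(0, 1), by decide, by decide, hexNorm_eq_iff.2
        (by dsimp only [Prod.mk_add_mk]; omega)⟩
  · rcases (by simpa using hs : b = k + 1 ∨ b = -(k + 1 : ℤ)) with h | h
    · exact ⟨(0, -1), by decide, by decide, hexNorm_eq_iff.2
        (by dsimp only [Prod.mk_add_mk]; omega)⟩
    · exact ⟨(-1, 1), by decide, by decide, hexNorm_eq_iff.2
        (by dsimp only [Prod.mk_add_mk]; omega)⟩
  · rcases (by simpa using hs : a = k + 1 ∨ a = -(k + 1 : ℤ)) with h | h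
    · exact ⟨(-1, 0), by decide, by decide, hexNorm_eq_iff.2
        (by dsimp only [Prod.mk_add_mk]; omega)⟩
    · exact ⟨(1, -1), by decide, by decide, hexNorm_eq_iff.2
        (by dsimp only [Prod.mk_add_mk]; omega)⟩
  · rcases (by simpa using hs : a + b = k + 1 ∨ a + b = -(k + 1 : ℤ)) with h | h
    · exact ⟨(0, -1), by decide, by decide, hexNorm_eq_iff.2
        (by dsimp only [Prod.mk_add_mk]; omega)⟩
    · exact ⟨(1, 0), by decide, by decide, hexNorm_eq_iff.2
        (by dsimp only [Prod.mk_add_mk]; omega)⟩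

/-- A corner of a hexagon has one neighbour in the previous layer, any other point of a side has
two, and these are consecutive around it. In the disc this makes two different predecessors of a
vertex adjacent. -/
theorem hexUnit_of_hexNorm_pred {p p' q : ℤ × ℤ} {k : ℕ} (hp : HexUnit (q - p))
    (hp' : HexUnit (q - p')) (hne : p ≠ p') (hq : hexNorm q = k + 1) (h : hexNorm p = k)
    (h' : hexNorm p' = k) : HexUnit (p' - p) := by
  obtain ⟨d, rfl⟩ : ∃ d, p = q - d := ⟨q - p, by abel⟩
  obtain ⟨d', rfl⟩ : ∃ d, p' = q - d := ⟨q - p', by abel⟩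
  rw [sub_sub_cancel] at hp hp'
  rw [sub_sub_sub_cancel_left]
  rw [hexNorm_eq_iff] at hq
  replace hq := hq.2
  replace h := hexNorm_le_iff.1 h.le
  replace h' := hexNorm_le_iff.1 h'.le
  obtain ⟨a, b⟩ := q
  simp only [Prod.fst_sub, Prod.snd_sub, Nat.cast_add, Nat.cast_one] at *
  rcases hp with rfl | rfl | rfl | rfl | rfl | rfl <;>
  rcases hp' with rfl | rfl | rfl | rfl | rfl | rfl <;>
  first | decide | exact absurd rfl hne | (exfalso; clear hne; simp only at *; omega)

theorem HexTriangle.cases {p q r : ℤ × ℤ} (h : HexTriangle p q r) :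
    ∃ d e, q = p + d ∧ r = p + e ∧ ((d, e) = ((1, 0), (0, 1)) ∨ (d, e) = ((0, 1), (-1, 1)) ∨
      (d, e) = ((-1, 1), (-1, 0)) ∨ (d, e) = ((-1, 0), (0, -1)) ∨ (d, e) = ((0, -1), (1, -1)) ∨
      (d, e) = ((1, -1), (1, 0)) ∨ (e, d) = ((1, 0), (0, 1)) ∨ (e, d) = ((0, 1), (-1, 1)) ∨
      (e, d) = ((-1, 1), (-1, 0)) ∨ (e, d) = ((-1, 0), (0, -1)) ∨ (e, d) = ((0, -1), (1, -1)) ∨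
      (e, d) = ((1, -1), (1, 0))) := by
  refine ⟨q - p, r - p, by abel, by abel, ?_⟩
  obtain ⟨h1, h2, h3⟩ := h
  rw [← sub_sub_sub_cancel_right r q p] at h3
  generalize q - p = d at *
  generalize r - p = e at *
  rcases h1 with rfl | rfl | rfl | rfl | rfl | rfl <;>
  rcases h2 with rfl | rfl | rfl | rfl | rfl | rfl <;> revert h3 <;> decide

/-- Otherwise the three edges would lie on sides of the hexagon in three different directions, and
three such sides never meet pairwise. Consequently every triangle of a ball has a vertex whose full
star is under control. -/
theorem HexTriangle.exists_hexNorm_lt {p q r : ℤ × ℤ} {n : ℕ} (h : HexTriangle p q r)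
    (hp : hexNorm p ≤ n) (hq : hexNorm q ≤ n) (hr : hexNorm r ≤ n) :
    hexNorm p < n ∨ hexNorm q < n ∨ hexNorm r < n := by
  by_contra! hc
  replace hp := hp.antisymm hc.1
  replace hq := hq.antisymm hc.2.1
  replace hr := hr.antisymm hc.2.2
  have hp' := hexNorm_le_iff.1 hp.le
  have hq' := hexNorm_le_iff.1 hq.le
  have hr' := hexNorm_le_iff.1 hr.le
  obtain ⟨d, e, rfl, rfl, hde⟩ := h.cases
  have h1 := hexNorm_side (by simpa using h.1) hp hq
  have h2 := hexNorm_side (by simpa using h.2.1) hp hr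
  have h3 := hexNorm_side h.2.2 hq (by simpa using hr)
  clear hp hq hr hc h
  simp only [Prod.mk.injEq] at hde
  rcases hde with ⟨rfl, rfl⟩ | ⟨rfl, rfl⟩ | ⟨rfl, rfl⟩ | ⟨rfl, rfl⟩ | ⟨rfl, rfl⟩ | ⟨rfl, rfl⟩ |
    ⟨rfl, rfl⟩ | ⟨rfl, rfl⟩ | ⟨rfl, rfl⟩ | ⟨rfl, rfl⟩ | ⟨rfl, rfl⟩ | ⟨rfl, rfl⟩ <;>
  simp at * <;> omega

/-- Two points completing an edge `p q` to a triangle are equal or opposite. -/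
theorem HexTriangle.eq_or_add_eq {p q r r' : ℤ × ℤ} (h : HexTriangle p q r)
    (h' : HexTriangle p q r') : r = r' ∨ r + r' = p + q := by
  obtain ⟨d, e, rfl, rfl, hde⟩ := h.cases
  obtain ⟨d', e', hd, rfl, hde'⟩ := h'.cases
  obtain rfl := add_left_cancel hd
  have key : e = e' ∨ e + e' = d := by
    simp only [Prod.mk.injEq] at hde hde'
    rcases hde with ⟨rfl, rfl⟩ | ⟨rfl, rfl⟩ | ⟨rfl, rfl⟩ | ⟨rfl, rfl⟩ | ⟨rfl, rfl⟩ | ⟨rfl, rfl⟩ |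
      ⟨rfl, rfl⟩ | ⟨rfl, rfl⟩ | ⟨rfl, rfl⟩ | ⟨rfl, rfl⟩ | ⟨rfl, rfl⟩ | ⟨rfl, rfl⟩ <;>
    · simp at hde'
      rcases hde' with rfl | rfl <;> decide
  rcases key with rfl | h
  · exact .inl rfl
  · right; rw [← h]; abel

/-- The sequence `α, β, β - α, -α, -β, α - β`: the six units in cyclic order. -/
def hexCycle (α β : ℤ × ℤ) : ZMod 6 → ℤ × ℤ
  | 0 => α
  | 1 => β
  | 2 => β - α
  | 3 => -α
  | 4 => -β
  | 5 => α - β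

/-- This recurrence is the reflection rule of a chart written around a vertex. Its period 6 is where
the degree enters. -/
theorem hexCycle_add_one_add (α β : ℤ × ℤ) (i : ZMod 6) :
    hexCycle α β (i + 1) + hexCycle α β (i - 1) = hexCycle α β i := by
  have h : ∀ i : ZMod 6, i = 0 ∨ i = 1 ∨ i = 2 ∨ i = 3 ∨ i = 4 ∨ i = 5 := by decide
  rcases h i with rfl | rfl | rfl | rfl | rfl | rfl
  · change β + (α - β) = α; abel
  · change (β - α) + α = β; abel
  · change -α + β = β - α; abel
  · change -β + (β - α) = -α; abel
  · change (α - β) + -α = -β; abel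
  · change α + -β = α - β; abel

/-- There are only twelve lattice triangles with ordered vertices starting at the origin, so
statements about `hexCycle α β` reduce to finite checks. -/
theorem HexTriangle.forall_of_zero {P : ℤ × ℤ → ℤ × ℤ → Prop} {α β : ℤ × ℤ}
    (h : HexTriangle 0 α β) (h1 : P (1, 0) (0, 1)) (h2 : P (0, 1) (-1, 1))
    (h3 : P (-1, 1) (-1, 0)) (h4 : P (-1, 0) (0, -1)) (h5 : P (0, -1) (1, -1))
    (h6 : P (1, -1) (1, 0)) (h1' : P (0, 1) (1, 0)) (h2' : P (-1, 1) (0, 1))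
    (h3' : P (-1, 0) (-1, 1)) (h4' : P (0, -1) (-1, 0)) (h5' : P (1, -1) (0, -1))
    (h6' : P (1, 0) (1, -1)) : P α β := by
  obtain ⟨d, e, hα, hβ, h⟩ := h.cases
  rw [zero_add] at hα hβ
  subst hα hβ
  simp only [Prod.mk.injEq] at h
  rcases h with ⟨rfl, rfl⟩ | ⟨rfl, rfl⟩ | ⟨rfl, rfl⟩ | ⟨rfl, rfl⟩ | ⟨rfl, rfl⟩ | ⟨rfl, rfl⟩ |
      ⟨rfl, rfl⟩ | ⟨rfl, rfl⟩ | ⟨rfl, rfl⟩ | ⟨rfl, rfl⟩ | ⟨rfl, rfl⟩ | ⟨rfl, rfl⟩ <;> assumption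

instance (p q r : ℤ × ℤ) : Decidable (HexTriangle p q r) := inferInstanceAs (Decidable (_ ∧ _))

theorem hexCycle_triangle {α β : ℤ × ℤ} (h : HexTriangle 0 α β) (i : ZMod 6) :
    HexTriangle 0 (hexCycle α β i) (hexCycle α β (i + 1)) := by
  revert i
  refine h.forall_of_zero (P := fun α β => ∀ i, HexTriangle 0 (hexCycle α β i)
    (hexCycle α β (i + 1))) ?_ ?_ ?_ ?_ ?_ ?_ ?_ ?_ ?_ ?_ ?_ ?_ <;> decide

theorem exists_hexCycle_eq {α β d : ℤ × ℤ} (h : HexTriangle 0 α β) (hd : HexUnit d) :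
    ∃ i, hexCycle α β i = d := by
  refine h.forall_of_zero (P := fun α β => ∃ i, hexCycle α β i = d)
    ?_ ?_ ?_ ?_ ?_ ?_ ?_ ?_ ?_ ?_ ?_ ?_ <;>
  rcases hd with rfl | rfl | rfl | rfl | rfl | rfl <;> decide

theorem eq_of_hexCycle_eq {α β : ℤ × ℤ} (h : HexTriangle 0 α β) {i j : ZMod 6}
    (hij : hexCycle α β i = hexCycle α β j) : i = j := by
  revert i j
  refine h.forall_of_zero (P := fun α β => ∀ {i j}, hexCycle α β i = hexCycle α β j → i = j)
    ?_ ?_ ?_ ?_ ?_ ?_ ?_ ?_ ?_ ?_ ?_ ?_ <;> decide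

/-- An edge has only two apexes, and the cyclic neighbours of index `i` already supply both. -/
theorem hexCycle_adj {α β : ℤ × ℤ} (h : HexTriangle 0 α β) {i j : ZMod 6}
    (hij : HexUnit (hexCycle α β j - hexCycle α β i)) : j = i + 1 ∨ i = j + 1 := by
  have h1 := hexCycle_triangle h i
  have h2 := (hexCycle_triangle h (i - 1)).swap_right
  rw [sub_add_cancel] at h2
  have h3 : HexTriangle 0 (hexCycle α β i) (hexCycle α β j) :=
    ⟨h1.1, (hexCycle_triangle h j).1, hij⟩
  rcases h1.eq_or_add_eq h3 with h4 | h4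
  · exact .inl (eq_of_hexCycle_eq h h4.symm)
  · right
    rw [← hexCycle_add_one_add α β i, zero_add] at h4
    rw [eq_of_hexCycle_eq h (add_left_cancel h4), sub_add_cancel]

end UniformComplex

namespace UniformComplex

/-! ### Vertex links: polygons at interior vertices, intervals at boundary vertices. -/

variable {W : Type*} {D : AbstractSimplicialComplex W}

open Classical in
/-- Three distinct vertices that span a triangle. -/
def IsTriangle (D : AbstractSimplicialComplex W) (a b c : W) : Prop :=
  a ≠ b ∧ a ≠ c ∧ b ≠ c ∧ {a, b, c} ∈ D.faces

open Classical in
theorem IsTriangle.swap_left {a b c : W} (h : IsTriangle D a b c) : IsTriangle D b a c :=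
  ⟨h.1.symm, h.2.2.1, h.2.1, by rw [Finset.insert_comm]; exact h.2.2.2⟩

open Classical in
theorem IsTriangle.swap_right {a b c : W} (h : IsTriangle D a b c) : IsTriangle D a c b :=
  ⟨h.2.1, h.1, h.2.2.1.symm, by rw [Finset.pair_comm]; exact h.2.2.2⟩

theorem IsTriangle.rotate {a b c : W} (h : IsTriangle D a b c) : IsTriangle D b c a :=
  h.swap_left.swap_right

theorem face_mono {s t : Finset W} (hs : s ∈ D.faces) (hts : t ⊆ s) (ht : t.Nonempty) :
    t ∈ D.faces :=
  (D.isRelLowerSet_faces hs).2 hts ht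

theorem IsTriangle.adj {a b c : W} (h : IsTriangle D a b c) : (oneSkeleton D).Adj a b := by
  classical
  refine ⟨h.1, face_mono h.2.2.2 ?_ (by simp)⟩
  intro x; simp only [Finset.mem_insert, Finset.mem_singleton]; tauto

theorem mem_link_singleton {w x : W} : {x} ∈ (link D w).faces ↔ (oneSkeleton D).Adj w x := by
  classical
  constructor
  · rintro ⟨-, h, h'⟩
    refine ⟨by simpa using h, by convert h'⟩
  · rintro ⟨h, h'⟩
    exact ⟨by simp, by simpa using h, by convert h'⟩

open Classical in
theorem mem_link_pair {w a b : W} (hab : a ≠ b) :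
    {a, b} ∈ (link D w).faces ↔ IsTriangle D w a b := by
  constructor
  · rintro ⟨-, h, h'⟩
    simp only [Finset.mem_insert, Finset.mem_singleton, not_or] at h
    exact ⟨h.1, h.2, hab, h'⟩
  · rintro ⟨h1, h2, -, h'⟩
    exact ⟨by simp, by simp [h1, h2], h'⟩

/-- The link of `w` is the `m`-gon with vertices `c i`. -/
structure CyclicLink (D : AbstractSimplicialComplex W) (w : W) (m : ℕ) (c : ZMod m → W) :
    Prop where
  injective : Function.Injective c
  adj_iff : ∀ x, (oneSkeleton D).Adj w x ↔ ∃ i, x = c i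
  triangle_iff : ∀ a b, IsTriangle D w a b ↔
    ∃ i, (a = c i ∧ b = c (i + 1)) ∨ (a = c (i + 1) ∧ b = c i)

/-- The link of `w` is the interval with `n` edges and vertices `c 0, ..., c n`. -/
structure LinearLink (D : AbstractSimplicialComplex W) (w : W) (n : ℕ) (c : ℕ → W) : Prop where
  injective : ∀ i ≤ n, ∀ j ≤ n, c i = c j → i = j
  adj_iff : ∀ x, (oneSkeleton D).Adj w x ↔ ∃ i ≤ n, x = c i
  triangle_iff : ∀ a b, IsTriangle D w a b ↔
    ∃ i < n, (a = c i ∧ b = c (i + 1)) ∨ (a = c (i + 1) ∧ b = c i)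

open Classical in
theorem pair_eq_pair_iff {a b c d : W} (hab : a ≠ b) :
    ({a, b} : Finset W) = {c, d} ↔ (a = c ∧ b = d) ∨ (a = d ∧ b = c) := by
  constructor
  · intro h
    have ha : a ∈ ({c, d} : Finset W) := h ▸ (by simp)
    have hb : b ∈ ({c, d} : Finset W) := h ▸ (by simp)
    simp only [Finset.mem_insert, Finset.mem_singleton] at ha hb
    rcases ha with rfl | rfl <;> rcases hb with rfl | rfl <;> simp_all
  · rintro (⟨rfl, rfl⟩ | ⟨rfl, rfl⟩)
    · rfl
    · rw [Finset.pair_comm]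

theorem IsCircle.exists_cyclicLink {w : W} (h : IsCircle (link D w)) :
    ∃ m, 3 ≤ m ∧ ∃ c, CyclicLink D w m c := by
  classical
  obtain ⟨m, hm, c, hc, hf⟩ := h
  have : Fact (1 < m) := ⟨by omega⟩
  have hne : ∀ i, c i ≠ c (i + 1) := fun i h => by simpa using hc h
  refine ⟨m, hm, c, hc, fun x => ?_, fun a b => ?_⟩
  · rw [← mem_link_singleton, hf]
    refine exists_congr fun i => ⟨?_, fun h => .inl (by rw [h])⟩
    rintro (h | h)
    · simpa using h
    · have := congrArg Finset.card h
      rw [Finset.card_singleton, Finset.card_pair (hne i)] at this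
      omega
  · by_cases hab : a = b
    · subst hab
      refine ⟨fun h => absurd rfl h.2.2.1, ?_⟩
      rintro ⟨i, ⟨h, h'⟩ | ⟨h, h'⟩⟩
      · exact absurd (h ▸ h') (hne i)
      · exact absurd (h' ▸ h) (hne i)
    rw [← mem_link_pair hab, hf]
    refine exists_congr fun i => ?_
    have : ({a, b} : Finset W) ≠ {c i} := fun h => by
      have := congrArg Finset.card h
      rw [Finset.card_singleton, Finset.card_pair hab] at this
      omega
    constructor
    · rintro (h | h)
      · exact absurd h this
      · exact (pair_eq_pair_iff hab).1 (by convert h)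
    · intro h
      right
      convert (pair_eq_pair_iff hab).2 h

theorem IsArc.exists_linearLink {w : W} (h : IsArc (link D w)) :
    ∃ n, 1 ≤ n ∧ ∃ c, LinearLink D w n c := by
  classical
  obtain ⟨n, hn, c, hc, hf⟩ := h
  let c' : ℕ → W := fun i => c ⟨min i n, by omega⟩
  have hinj : ∀ i ≤ n, ∀ j ≤ n, c' i = c' j → i = j := by
    intro i hi j hj h
    have := congrArg Fin.val (hc h)
    simpa [hi, hj] using this
  have hne : ∀ i < n, c' i ≠ c' (i + 1) := fun i hi h => by
    have := hinj i (by omega) (i + 1) (by omega) h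
    omega
  have hf' : ∀ s, s ∈ (link D w).faces ↔
      (∃ i ≤ n, s = {c' i}) ∨ ∃ i < n, s = {c' i, c' (i + 1)} := by
    intro s
    rw [hf]
    refine or_congr ⟨?_, ?_⟩ ⟨?_, ?_⟩
    · rintro ⟨i, rfl⟩
      exact ⟨i, by omega, by simp [c', Nat.min_eq_left (Nat.lt_succ_iff.1 i.2)]⟩
    · rintro ⟨i, hi, rfl⟩
      exact ⟨⟨i, by omega⟩, by simp [c', hi]⟩
    · rintro ⟨i, rfl⟩
      refine ⟨i, i.2, ?_⟩
      have h1 : min i.1 n = i.1 := by omega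
      have h2 : min (i.1 + 1) n = i.1 + 1 := by omega
      simp only [c', h1, h2]
      rfl
    · rintro ⟨i, hi, rfl⟩
      refine ⟨⟨i, hi⟩, ?_⟩
      have h1 : min i n = i := by omega
      have h2 : min (i + 1) n = i + 1 := by omega
      simp only [c', h1, h2]
      rfl
  refine ⟨n, hn, c', hinj, fun x => ?_, fun a b => ?_⟩
  · rw [← mem_link_singleton, hf']
    constructor
    · rintro (⟨i, hi, h⟩ | ⟨i, hi, h⟩)
      · exact ⟨i, hi, by simpa using h⟩
      · have := congrArg Finset.card h
        rw [Finset.card_singleton, Finset.card_pair (hne i hi)] at this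
        omega
    · rintro ⟨i, hi, h⟩
      exact .inl ⟨i, hi, by rw [h]⟩
  · by_cases hab : a = b
    · subst hab
      refine ⟨fun h => absurd rfl h.2.2.1, ?_⟩
      rintro ⟨i, hi, ⟨h, h'⟩ | ⟨h, h'⟩⟩
      · exact absurd (h ▸ h') (hne i hi)
      · exact absurd (h' ▸ h) (hne i hi)
    rw [← mem_link_pair hab, hf']
    constructor
    · rintro (⟨i, hi, h⟩ | ⟨i, hi, h⟩)
      · have := congrArg Finset.card h
        rw [Finset.card_singleton, Finset.card_pair hab] at this
        omega
      · exact ⟨i, hi, (pair_eq_pair_iff hab).1 (by convert h)⟩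
    · rintro ⟨i, hi, h⟩
      refine .inr ⟨i, hi, ?_⟩
      convert (pair_eq_pair_iff hab).2 h

open Classical in
/-- The triangles containing an edge correspond to the vertices completing it to a triangle. -/
theorem mem_triangles_pair_subset {w a : W} (hwa : w ≠ a) {t : Finset W} :
    (t ∈ triangles D ∧ {w, a} ⊆ t) ↔ ∃ b, IsTriangle D w a b ∧ t = {w, a, b} := by
  constructor
  · rintro ⟨⟨ht, h3⟩, hsub⟩
    have hc : (t \ {w, a}).card = 1 := by
      rw [Finset.card_sdiff_of_subset hsub, h3, Finset.card_pair hwa]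
    obtain ⟨b, hb⟩ := Finset.card_eq_one.1 hc
    have hbm : b ∈ t \ {w, a} := hb ▸ (by simp)
    simp only [Finset.mem_sdiff, Finset.mem_insert, Finset.mem_singleton, not_or] at hbm
    have ht' : t = {w, a, b} := by
      rw [← Finset.sdiff_union_of_subset hsub, hb]
      ext x; simp only [Finset.mem_union, Finset.mem_insert, Finset.mem_singleton]; tauto
    exact ⟨b, ⟨hwa, Ne.symm hbm.2.1, Ne.symm hbm.2.2, ht' ▸ ht⟩, ht'⟩
  · rintro ⟨b, h, rfl⟩
    refine ⟨⟨h.2.2.2, Finset.card_eq_three.2 ⟨w, a, b, h.1, h.2.1, h.2.2.1, rfl⟩⟩, ?_⟩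
    intro x; simp only [Finset.mem_insert, Finset.mem_singleton]; tauto

/-- An edge from `w` to `c i` lies in the triangles with apexes `c (i + 1)` and `c (i - 1)`, which
differ because `m` does not divide 2. So no edge at `w` is a boundary edge. -/
theorem CyclicLink.isInterior {w : W} {m : ℕ} {c : ZMod m → W} (h : CyclicLink D w m c)
    (hm : 3 ≤ m) : IsInterior D w := by
  classical
  rintro ⟨-, e, he, h2, h1, hwe⟩
  rw [Finset.singleton_subset_iff] at hwe
  obtain ⟨a, ha, rfl⟩ : ∃ a, w ≠ a ∧ e = {w, a} := by
    obtain ⟨x, y, hxy, rfl⟩ := Finset.card_eq_two.1 h2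
    simp only [Finset.mem_insert, Finset.mem_singleton] at hwe
    rcases hwe with rfl | rfl
    · exact ⟨y, hxy, rfl⟩
    · exact ⟨x, hxy.symm, Finset.pair_comm _ _⟩
  obtain ⟨i, rfl⟩ := (h.adj_iff a).1 ⟨ha, by convert he⟩
  obtain ⟨t, ht⟩ := Set.ncard_eq_one.1 h1
  have key : ∀ b, IsTriangle D w (c i) b → t = {w, c i, b} := fun b hb => by
    have := (mem_triangles_pair_subset ha (t := {w, c i, b})).2 ⟨b, hb, rfl⟩
    have h' : ({w, c i, b} : Finset W) ∈ {t | t ∈ triangles D ∧ {w, c i} ⊆ t} := this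
    rw [ht] at h'
    exact h'.symm
  have hb1 : IsTriangle D w (c i) (c (i + 1)) := (h.triangle_iff _ _).2 ⟨i, .inl ⟨rfl, rfl⟩⟩
  have hb2 : IsTriangle D w (c i) (c (i - 1)) :=
    (h.triangle_iff _ _).2 ⟨i - 1, .inr ⟨by rw [sub_add_cancel], rfl⟩⟩
  have hmem : c (i + 1) ∈ ({w, c i, c (i - 1)} : Finset W) := by
    rw [← key _ hb2, key _ hb1]; simp
  simp only [Finset.mem_insert, Finset.mem_singleton] at hmem
  rcases hmem with h' | h' | h'
  · exact hb1.2.1 h'.symm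
  · exact hb1.2.2.1 h'.symm
  · have h2 : ((2 : ℕ) : ZMod m) = 0 := by
      have := h.injective h'
      push_cast
      linear_combination this
    rw [ZMod.natCast_eq_zero_iff] at h2
    have := Nat.le_of_dvd (by norm_num) h2
    omega

/-- The edge from `w` to an end of its link lies in a single triangle. -/
theorem LinearLink.not_isInterior {w : W} {n : ℕ} {c : ℕ → W} (h : LinearLink D w n c)
    (hn : 1 ≤ n) : ¬ IsInterior D w := by
  classical
  intro hw
  have hadj := (h.adj_iff (c 0)).2 ⟨0, by omega, rfl⟩
  refine hw ⟨by simp, {w, c 0}, by convert hadj.2, Finset.card_pair hadj.1, ?_, by simp⟩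
  rw [Set.ncard_eq_one]
  refine ⟨{w, c 0, c 1}, ?_⟩
  ext t
  have := mem_triangles_pair_subset (D := D) hadj.1 (t := t)
  refine this.trans ?_
  constructor
  · rintro ⟨b, hb, rfl⟩
    obtain ⟨i, hi, ⟨h1, rfl⟩ | ⟨h1, -⟩⟩ := (h.triangle_iff _ _).1 hb
    · obtain rfl := h.injective _ (by omega) _ (by omega) h1
      rfl
    · have := h.injective _ (by omega) _ (by omega) h1
      omega
  · rintro rfl
    exact ⟨c 1, (h.triangle_iff _ _).2 ⟨0, by omega, .inl ⟨rfl, rfl⟩⟩, rfl⟩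

/-- In a disc whose interior vertices have degree `6`, links are hexagons or intervals. -/
structure IsHexSurface (D : AbstractSimplicialComplex W) : Prop where
  link : ∀ w, (∃ c, CyclicLink D w 6 c) ∨ ∃ n, 1 ≤ n ∧ ∃ c, LinearLink D w n c

theorem IsDisc.isHexSurface (hD : IsDisc D)
    (h6 : ∀ w, IsInterior D w → ((oneSkeleton D).neighborSet w).ncard = 6) : IsHexSurface D where
  link w := by
    rcases hD.link_circle_or_arc w with h | h
    · obtain ⟨m, hm, c, hc⟩ := h.exists_cyclicLink
      have := h6 w (hc.isInterior hm)
      have hr : (oneSkeleton D).neighborSet w = Set.range c := by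
        ext x
        rw [SimpleGraph.mem_neighborSet, hc.adj_iff]
        simp only [Set.mem_range, eq_comm]
      rw [hr, ← Set.image_univ, Set.ncard_image_of_injective _ hc.injective, Set.ncard_univ,
        Nat.card_zmod] at this
      subst this
      exact .inl ⟨c, hc⟩
    · exact .inr h.exists_linearLink

theorem IsHexSurface.exists_cyclicLink (hD : IsHexSurface D) {w : W} (hw : IsInterior D w) :
    ∃ c, CyclicLink D w 6 c := by
  rcases hD.link w with h | ⟨n, hn, c, hc⟩
  · exact h
  · exact absurd hw (hc.not_isInterior hn)

theorem IsHexSurface.exists_triangle (hD : IsHexSurface D) {w x : W}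
    (h : (oneSkeleton D).Adj w x) : ∃ y, IsTriangle D w x y := by
  rcases hD.link w with ⟨c, hc⟩ | ⟨n, hn, c, hc⟩
  · obtain ⟨i, rfl⟩ := (hc.adj_iff x).1 h
    exact ⟨_, (hc.triangle_iff _ _).2 ⟨i, .inl ⟨rfl, rfl⟩⟩⟩
  · obtain ⟨i, hi, rfl⟩ := (hc.adj_iff x).1 h
    rcases hi.lt_or_eq with hi | rfl
    · exact ⟨_, (hc.triangle_iff _ _).2 ⟨i, hi, .inl ⟨rfl, rfl⟩⟩⟩
    · exact ⟨_, (hc.triangle_iff _ _).2 ⟨i - 1, by omega,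
        .inr ⟨by rw [Nat.sub_add_cancel hn], rfl⟩⟩⟩

/-- Links carry an angle function with values in `ZMod 6`. -/
theorem IsHexSurface.exists_angle (hD : IsHexSurface D) (w : W) : ∃ κ : W → ZMod 6,
    (∀ a b, IsTriangle D w a b → κ b = κ a + 1 ∨ κ b = κ a - 1) ∧
    ∀ a b c, IsTriangle D w a b → IsTriangle D w a c → b ≠ c → κ b + κ c = 2 * κ a := by
  classical
  rcases hD.link w with ⟨c, hc⟩ | ⟨n, hn, c, hc⟩
  · have hκ : ∀ i, Function.invFun c (c i) = i := Function.leftInverse_invFun hc.injective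
    refine ⟨Function.invFun c, fun a b h => ?_, fun a b b' h h' hne => ?_⟩
    · obtain ⟨i, ⟨rfl, rfl⟩ | ⟨rfl, rfl⟩⟩ := (hc.triangle_iff _ _).1 h
      · left; rw [hκ, hκ]
      · right; rw [hκ, hκ]; ring
    · obtain ⟨i, hi⟩ := (hc.triangle_iff _ _).1 h
      obtain ⟨j, hj⟩ := (hc.triangle_iff _ _).1 h'
      rcases hi with ⟨rfl, rfl⟩ | ⟨rfl, rfl⟩ <;> rcases hj with ⟨hj, rfl⟩ | ⟨hj, rfl⟩
      · obtain rfl := hc.injective hj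
        exact absurd rfl hne
      · obtain rfl := hc.injective hj
        simp only [hκ]; ring
      · obtain rfl := hc.injective hj
        simp only [hκ]; ring
      · obtain rfl := add_right_cancel (hc.injective hj)
        exact absurd rfl hne
  -- On an interval the index modulo 6 is the angle. It need not be injective, since the interval
  -- may be long. The value 0 off the link plays no role.
  · let κ : W → ZMod 6 := fun x => if h : ∃ i ≤ n, x = c i then ((h.choose : ℕ) : ZMod 6) else 0
    have hκ : ∀ i ≤ n, κ (c i) = (i : ZMod 6) := fun i hi => by
      have h : ∃ j ≤ n, c i = c j := ⟨i, hi, rfl⟩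
      simp only [κ, dif_pos h]
      exact congrArg _ (hc.injective _ hi _ h.choose_spec.1 h.choose_spec.2).symm
    refine ⟨κ, fun a b h => ?_, fun a b b' h h' hne => ?_⟩
    · obtain ⟨i, hin, ⟨rfl, rfl⟩ | ⟨rfl, rfl⟩⟩ := (hc.triangle_iff _ _).1 h
      · left; rw [hκ _ hin.le, hκ _ hin]; push_cast; ring
      · right; rw [hκ _ hin.le, hκ _ hin]; push_cast; ring
    · obtain ⟨i, hin, hi⟩ := (hc.triangle_iff _ _).1 h
      obtain ⟨j, hjn, hj⟩ := (hc.triangle_iff _ _).1 h'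
      rcases hi with ⟨rfl, rfl⟩ | ⟨rfl, rfl⟩ <;> rcases hj with ⟨hj, rfl⟩ | ⟨hj, rfl⟩
      · obtain rfl := hc.injective _ (by omega) _ (by omega) hj
        exact absurd rfl hne
      · obtain rfl := hc.injective _ (by omega) _ (by omega) hj
        rw [hκ _ hin, hκ _ hin.le, hκ _ hjn.le]; push_cast; ring
      · obtain rfl := hc.injective _ (by omega) _ (by omega) hj
        rw [hκ _ hin, hκ _ hin.le, hκ _ hjn]; push_cast; ring
      · obtain rfl := Nat.succ.inj (hc.injective _ (by omega) _ (by omega) hj)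
        exact absurd rfl hne

/-- Links are connected: a symmetric relation on the edges of a link that passes from one edge to
the next holds for all edges as soon as it holds for one. -/
theorem IsHexSurface.link_induction (hD : IsHexSurface D) {w : W} {P : W → W → Prop}
    (hsymm : ∀ a b, P a b → P b a)
    (hstep : ∀ a b c, IsTriangle D w a b → IsTriangle D w b c → P a b → P b c)
    {a₀ b₀ : W} (h₀ : IsTriangle D w a₀ b₀) (hP : P a₀ b₀) {a b : W} (h : IsTriangle D w a b) :
    P a b := by
  rcases hD.link w with ⟨c, hc⟩ | ⟨n, hn, c, hc⟩
  · have hT : ∀ i, IsTriangle D w (c i) (c (i + 1)) := fun i =>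
      (hc.triangle_iff _ _).2 ⟨i, .inl ⟨rfl, rfl⟩⟩
    obtain ⟨i, hi⟩ := (hc.triangle_iff _ _).1 h₀
    have hPi : P (c i) (c (i + 1)) := by
      rcases hi with ⟨rfl, rfl⟩ | ⟨rfl, rfl⟩
      exacts [hP, hsymm _ _ hP]
    -- On a polygon, moving forward reaches every edge.
    have hall : ∀ k : ℕ, P (c (i + k)) (c (i + k + 1)) := by
      intro k
      induction k with
      | zero => simpa using hPi
      | succ k ih =>
        have := hstep _ _ _ (hT _) (hT _) ih
        push_cast
        rwa [← add_assoc]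
    obtain ⟨j, hj⟩ := (hc.triangle_iff _ _).1 h
    have hPj := hall (j - i).val
    rw [ZMod.natCast_zmod_val, add_sub_cancel] at hPj
    rcases hj with ⟨rfl, rfl⟩ | ⟨rfl, rfl⟩
    exacts [hPj, hsymm _ _ hPj]
  · have hT : ∀ i < n, IsTriangle D w (c i) (c (i + 1)) := fun i hi =>
      (hc.triangle_iff _ _).2 ⟨i, hi, .inl ⟨rfl, rfl⟩⟩
    obtain ⟨i, hin, hi⟩ := (hc.triangle_iff _ _).1 h₀
    have hPi : P (c i) (c (i + 1)) := by
      rcases hi with ⟨rfl, rfl⟩ | ⟨rfl, rfl⟩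
      exacts [hP, hsymm _ _ hP]
    -- On an interval one must also move backward, which the symmetry of `P` permits.
    have hstep' : ∀ k, k + 1 < n → (P (c k) (c (k + 1)) ↔ P (c (k + 1)) (c (k + 2))) := by
      intro k hk
      refine ⟨hstep _ _ _ (hT k (by omega)) (hT (k + 1) hk), fun h => ?_⟩
      exact hsymm _ _ (hstep _ _ _ (hT (k + 1) hk).swap_right (hT k (by omega)).swap_right
        (hsymm _ _ h))
    have hall : ∀ k < n, (P (c k) (c (k + 1)) ↔ P (c 0) (c 1)) := by
      intro k hk
      induction k with
      | zero => rfl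
      | succ k ih => rw [← ih (by omega), hstep' k hk]
    obtain ⟨j, hjn, hj⟩ := (hc.triangle_iff _ _).1 h
    have hPj := (hall j hjn).2 ((hall i hin).1 hPi)
    rcases hj with ⟨rfl, rfl⟩ | ⟨rfl, rfl⟩
    exacts [hPj, hsymm _ _ hPj]

/-! ### Charts, their transport along edge paths, and the developing map. -/

theorem hexTriangle_iff_sub {p q r : ℤ × ℤ} :
    HexTriangle p q r ↔ HexTriangle 0 (q - p) (r - p) := by
  simp [HexTriangle]

variable {W : Type*} {D : AbstractSimplicialComplex W}

/-- `φ` develops the star of `u` in the triangular lattice: triangles go to triangles, and triangles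
with a common edge at `u` go to opposite triangles. -/
structure IsChart (D : AbstractSimplicialComplex W) (u : W) (φ : W → ℤ × ℤ) : Prop where
  triangle : ∀ a b, IsTriangle D u a b → HexTriangle (φ u) (φ a) (φ b)
  flip : ∀ a b c, IsTriangle D u a b → IsTriangle D u a c → b ≠ c → φ b + φ c = φ u + φ a

/-- A chart at `u` that vanishes outside the star of `u`. -/
structure IsGerm (D : AbstractSimplicialComplex W) (u : W) (φ : W → ℤ × ℤ) : Prop
    extends IsChart D u φ where
  eq_zero : ∀ x, x ≠ u → ¬ (oneSkeleton D).Adj u x → φ x = 0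

/-- Shift the angle function, and reverse its orientation if necessary, so that `a` and `b` get
angles 0 and 1. Then read off the cycle of units that starts with `q - p`, `r - p`. -/
theorem IsHexSurface.exists_germ (hD : IsHexSurface D) {w a b : W} (h : IsTriangle D w a b)
    {p q r : ℤ × ℤ} (hp : HexTriangle p q r) :
    ∃ ψ, IsGerm D w ψ ∧ ψ w = p ∧ ψ a = q ∧ ψ b = r := by
  classical
  obtain ⟨f, hf1, hf2, hfa, hfb⟩ : ∃ f : W → ZMod 6,
      (∀ a b, IsTriangle D w a b → f b = f a + 1 ∨ f b = f a - 1) ∧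
      (∀ a b c, IsTriangle D w a b → IsTriangle D w a c → b ≠ c → f b + f c = 2 * f a) ∧
      f a = 0 ∧ f b = 1 := by
    obtain ⟨κ, h1, h2⟩ := hD.exists_angle w
    rcases h1 _ _ h with hab | hab
    · refine ⟨fun x => κ x - κ a, fun x y hxy => ?_, fun x y z hy hz hne => ?_, by simp,
        by simp [hab]⟩
      · refine (h1 _ _ hxy).imp ?_ ?_ <;> intro h <;> dsimp only <;> rw [h] <;> ring
      · linear_combination h2 _ _ _ hy hz hne
    · refine ⟨fun x => κ a - κ x, fun x y hxy => ?_, fun x y z hy hz hne => ?_, by simp,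
        by simp [hab]⟩
      · refine (h1 _ _ hxy).symm.imp ?_ ?_ <;> intro h <;> dsimp only <;> rw [h] <;> ring
      · linear_combination -h2 _ _ _ hy hz hne
  have h0 := hexTriangle_iff_sub.1 hp
  let ψ : W → ℤ × ℤ := fun x => if x = w then p else
    if (oneSkeleton D).Adj w x then p + hexCycle (q - p) (r - p) (f x) else 0
  have hw : ψ w = p := if_pos rfl
  have hψ : ∀ x, (oneSkeleton D).Adj w x → ψ x = p + hexCycle (q - p) (r - p) (f x) :=
    fun x hx => by simp only [ψ, if_neg hx.ne.symm, if_pos hx]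
  refine ⟨ψ, ⟨⟨fun x y hxy => ?_, fun x y z hy hz hne => ?_⟩, fun x hx hwx => ?_⟩, hw, ?_, ?_⟩
  · rw [hexTriangle_iff_sub, hw, hψ x hxy.adj, hψ y hxy.swap_right.adj, add_sub_cancel_left,
      add_sub_cancel_left]
    rcases hf1 _ _ hxy with h | h
    · rw [h]; exact hexCycle_triangle h0 _
    · obtain h' : f x = f y + 1 := by rw [h]; ring
      rw [h']; exact (hexCycle_triangle h0 _).swap_right
  · rw [hw, hψ x hy.adj, hψ y hy.swap_right.adj, hψ z hz.swap_right.adj,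
      ← hexCycle_add_one_add _ _ (f x)]
    have h2 := hf2 _ _ _ hy hz hne
    rcases hf1 _ _ hy with h | h
    · have : f z = f x - 1 := by rw [h] at h2; linear_combination h2
      rw [h, this]; abel
    · have : f z = f x + 1 := by rw [h] at h2; linear_combination h2
      rw [h, this]; abel
  · simp only [ψ, if_neg hx, if_neg hwx]
  · rw [hψ a h.adj, hfa]
    change p + (q - p) = q; abel
  · rw [hψ b h.swap_right.adj, hfb]
    change p + (r - p) = r; abel

/-- The reflection rule propagates the values from one triangle to the next, and the link is
connected. -/
theorem IsHexSurface.chart_eq (hD : IsHexSurface D) {w : W} {φ ψ : W → ℤ × ℤ}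
    (hφ : IsChart D w φ) (hψ : IsChart D w ψ) {a b : W} (h : IsTriangle D w a b)
    (hw : φ w = ψ w) (ha : φ a = ψ a) (hb : φ b = ψ b) {x : W}
    (hx : (oneSkeleton D).Adj w x) : φ x = ψ x := by
  obtain ⟨y, hy⟩ := hD.exists_triangle hx
  refine (hD.link_induction (P := fun a b => φ a = ψ a ∧ φ b = ψ b) (fun a b h => h.symm) ?_ h
    ⟨ha, hb⟩ hy).1
  rintro a b c hab hbc ⟨h1, h2⟩
  refine ⟨h2, ?_⟩
  by_cases hac : a = c
  · rw [← hac, h1]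
  · have e1 := hφ.flip _ _ _ hab.swap_right hbc hac
    have e2 := hψ.flip _ _ _ hab.swap_right hbc hac
    rw [h1, h2, hw, ← e2] at e1
    exact add_left_cancel e1

/-- Vanishing outside the star turns agreement on the star into equality of functions, so results of
transport can be compared directly. -/
theorem IsHexSurface.germ_eq (hD : IsHexSurface D) {w : W} {φ ψ : W → ℤ × ℤ}
    (hφ : IsGerm D w φ) (hψ : IsGerm D w ψ) {a b : W} (h : IsTriangle D w a b)
    (hw : φ w = ψ w) (ha : φ a = ψ a) (hb : φ b = ψ b) : φ = ψ := by
  funext x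
  by_cases hx : x = w
  · rw [hx, hw]
  · by_cases hwx : (oneSkeleton D).Adj w x
    · exact hD.chart_eq hφ.1 hψ.1 h hw ha hb hwx
    · rw [hφ.eq_zero x hx hwx, hψ.eq_zero x hx hwx]

/-- `φ` and `ψ` agree on the edge `u w` and on the triangles containing it. -/
structure AgreeOnEdge (D : AbstractSimplicialComplex W) (u w : W) (φ ψ : W → ℤ × ℤ) : Prop where
  left : φ u = ψ u
  right : φ w = ψ w
  apex : ∀ x, IsTriangle D u w x → φ x = ψ x

theorem AgreeOnEdge.symm {u w : W} {φ ψ : W → ℤ × ℤ} (h : AgreeOnEdge D u w φ ψ) :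
    AgreeOnEdge D w u ψ φ :=
  ⟨h.right.symm, h.left.symm, fun x hx => (h.apex x hx.swap_left).symm⟩

/-- One triangle `u w x` fixes `ψ`. For a further triangle on the same edge, the reflection rules at
`u` and at `w` give the same apex, as both are symmetric in the two ends of the edge. -/
theorem IsHexSurface.exists_agreeOnEdge (hD : IsHexSurface D) {u w : W}
    (h : (oneSkeleton D).Adj u w) {φ : W → ℤ × ℤ} (hφ : IsChart D u φ) :
    ∃ ψ, IsGerm D w ψ ∧ AgreeOnEdge D u w φ ψ := by
  obtain ⟨x, hx⟩ := hD.exists_triangle h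
  obtain ⟨ψ, hψ, h1, h2, h3⟩ := hD.exists_germ hx.swap_left (hφ.triangle _ _ hx).swap_left
  refine ⟨ψ, hψ, h2.symm, h1.symm, fun y hy => ?_⟩
  by_cases hxy : x = y
  · rw [← hxy, h3]
  · have e1 := hφ.flip _ _ _ hx hy hxy
    have e2 := hψ.flip _ _ _ hx.swap_left hy.swap_left hxy
    rw [h1, h2, h3, add_comm (φ w), ← e1] at e2
    exact (add_left_cancel e2).symm

theorem IsHexSurface.agreeOnEdge_unique (hD : IsHexSurface D) {u w : W}
    (h : (oneSkeleton D).Adj u w) {φ ψ ψ' : W → ℤ × ℤ} (hψ : IsGerm D w ψ) (hψ' : IsGerm D w ψ')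
    (h1 : AgreeOnEdge D u w φ ψ) (h2 : AgreeOnEdge D u w φ ψ') : ψ = ψ' := by
  obtain ⟨x, hx⟩ := hD.exists_triangle h
  exact hD.germ_eq hψ hψ' hx.swap_left (h1.right.symm.trans h2.right)
    (h1.left.symm.trans h2.left) ((h1.apex x hx).symm.trans (h2.apex x hx))

open Classical in
/-- Transport of a germ along an edge. -/
noncomputable def edgeTransport (D : AbstractSimplicialComplex W) (u w : W) (φ : W → ℤ × ℤ) :
    W → ℤ × ℤ :=
  if h : ∃ ψ, IsGerm D w ψ ∧ AgreeOnEdge D u w φ ψ then h.choose else φ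

theorem IsHexSurface.edgeTransport_spec (hD : IsHexSurface D) {u w : W}
    (h : (oneSkeleton D).Adj u w) {φ : W → ℤ × ℤ} (hφ : IsChart D u φ) :
    IsGerm D w (edgeTransport D u w φ) ∧ AgreeOnEdge D u w φ (edgeTransport D u w φ) := by
  have hex := hD.exists_agreeOnEdge h hφ
  rw [edgeTransport, dif_pos hex]
  exact hex.choose_spec

theorem IsHexSurface.edgeTransport_backtrack (hD : IsHexSurface D) {u w : W}
    (h : (oneSkeleton D).Adj u w) {φ : W → ℤ × ℤ} (hφ : IsGerm D u φ) :
    edgeTransport D w u (edgeTransport D u w φ) = φ := by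
  obtain ⟨h1, h2⟩ := hD.edgeTransport_spec h hφ.1
  obtain ⟨h3, h4⟩ := hD.edgeTransport_spec h.symm h1.1
  exact hD.agreeOnEdge_unique h.symm h3 hφ h4 h2.symm

/-- Each transport preserves the values on triangles containing its edge. Both sides therefore keep
the values of `φ` on `u`, `v`, `w`, and a germ at `w` is determined by these. -/
theorem IsHexSurface.edgeTransport_triangle (hD : IsHexSurface D) {u v w : W}
    (h : IsTriangle D u v w) {φ : W → ℤ × ℤ} (hφ : IsGerm D u φ) :
    edgeTransport D v w (edgeTransport D u v φ) = edgeTransport D u w φ := by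
  obtain ⟨h1, h2⟩ := hD.edgeTransport_spec h.adj hφ.1
  obtain ⟨h3, h4⟩ := hD.edgeTransport_spec h.rotate.adj h1.1
  obtain ⟨h5, h6⟩ := hD.edgeTransport_spec h.swap_right.adj hφ.1
  refine hD.germ_eq h3 h5 h.rotate.rotate ?_ ?_ ?_
  · rw [← h4.right, ← h2.apex _ h, h6.right]
  · rw [← h4.apex _ h.rotate, ← h2.left, h6.left]
  · rw [← h4.left, ← h2.right, h6.apex _ h.swap_right]

/-- Transport of a germ along an edge path. -/
noncomputable def transport (D : AbstractSimplicialComplex W) :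
    ∀ {u w : W}, (oneSkeleton D).Walk u w → (W → ℤ × ℤ) → W → ℤ × ℤ
  | _, _, .nil, φ => φ
  | u, _, .cons (v := v) _ p, φ => transport D p (edgeTransport D u v φ)

theorem transport_append {u v w : W} (p : (oneSkeleton D).Walk u v)
    (q : (oneSkeleton D).Walk v w) (φ : W → ℤ × ℤ) :
    transport D (p.append q) φ = transport D q (transport D p φ) := by
  induction p generalizing φ with
  | nil => rfl
  | cons h p ih => exact ih q _

theorem IsHexSurface.isGerm_transport (hD : IsHexSurface D) {u w : W}
    (p : (oneSkeleton D).Walk u w) {φ : W → ℤ × ℤ} (hφ : IsGerm D u φ) :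
    IsGerm D w (transport D p φ) := by
  induction p generalizing φ with
  | nil => exact hφ
  | cons h p ih => exact ih (hD.edgeTransport_spec h hφ.1).1

theorem IsHexSurface.transport_reverse (hD : IsHexSurface D) {u w : W}
    (p : (oneSkeleton D).Walk u w) {φ : W → ℤ × ℤ} (hφ : IsGerm D w φ) :
    transport D p (transport D p.reverse φ) = φ := by
  induction p with
  | nil => rfl
  | cons h p ih =>
    rw [SimpleGraph.Walk.reverse_cons, transport_append]
    change transport D p (edgeTransport D _ _ (edgeTransport D _ _ _)) = φ
    rw [hD.edgeTransport_backtrack h.symm (hD.isGerm_transport _ hφ), ih hφ]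

/-- The generators of homotopy are backtracks and triangles, and transport is invariant under both.
-/
theorem IsHexSurface.transport_homotopic (hD : IsHexSurface D) {u w : W}
    {p q : (oneSkeleton D).Walk u w} (h : PathHomotopic D p q) {φ : W → ℤ × ℤ}
    (hφ : IsGerm D u φ) : transport D p φ = transport D q φ := by
  induction h generalizing φ with
  | refl => rfl
  | symm _ ih => exact (ih hφ).symm
  | trans _ _ ih ih' => exact (ih hφ).trans (ih' hφ)
  | cons h _ ih => exact ih (hD.edgeTransport_spec h hφ.1).1
  | backtrack h h' p =>
    change transport D p (edgeTransport D _ _ (edgeTransport D _ _ φ)) = _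
    rw [hD.edgeTransport_backtrack h hφ]
  | triangle huv hvw huw hface p =>
    change transport D p (edgeTransport D _ _ (edgeTransport D _ _ φ)) =
      transport D p (edgeTransport D _ _ φ)
    rw [hD.edgeTransport_triangle ⟨huv.1, huw.1, hvw.1, hface⟩ hφ]

theorem IsHexSurface.transport_eq (hD : IsHexSurface D) (hs : IsSimplyConnected D) {u w : W}
    (p q : (oneSkeleton D).Walk u w) {φ : W → ℤ × ℤ} (hφ : IsGerm D u φ) :
    transport D p φ = transport D q φ := by
  have h := hD.transport_homotopic (hs.null_homotopic u (p.append q.reverse)) hφ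
  rw [transport_append] at h
  rw [← hD.transport_reverse q (hD.isGerm_transport p hφ), h]
  rfl

/-- The developing map of a simply connected surface with hexagonal links. -/
theorem IsHexSurface.exists_development (hD : IsHexSurface D) (hs : IsSimplyConnected D) (v : W) :
    ∃ dev : W → ℤ × ℤ, dev v = 0 ∧ ∀ w, IsChart D w dev := by
  obtain ⟨φ, hφ, hv⟩ : ∃ φ, IsGerm D v φ ∧ φ v = 0 := by
    obtain ⟨a, ha⟩ : ∃ a, (oneSkeleton D).Adj v a := by
      rcases hD.link v with ⟨c, hc⟩ | ⟨n, hn, c, hc⟩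
      · exact ⟨_, (hc.adj_iff _).2 ⟨0, rfl⟩⟩
      · exact ⟨_, (hc.adj_iff _).2 ⟨0, by omega, rfl⟩⟩
    obtain ⟨b, hb⟩ := hD.exists_triangle ha
    obtain ⟨φ, hφ, h, -⟩ := hD.exists_germ hb (p := 0) (q := (1, 0)) (r := (0, 1)) (by decide)
    exact ⟨φ, hφ, h⟩
  choose p hp using fun w => (⟨(hs.connected v w).some, trivial⟩ :
    ∃ _ : (oneSkeleton D).Walk v w, True)
  -- A path to `w` followed by the edge to `x` may replace the chosen path to `x`, and edge
  -- transport does not change the value at `x`. Thus the global map agrees on the star of `w` with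
  -- the germ transported to `w`.
  have key : ∀ w x, (oneSkeleton D).Adj w x →
      transport D (p x) φ x = transport D (p w) φ x := by
    intro w x h
    rw [hD.transport_eq hs (p x) ((p w).append (.cons h .nil)) hφ, transport_append]
    exact (hD.edgeTransport_spec h (hD.isGerm_transport (p w) hφ).1).2.right.symm
  refine ⟨fun w => transport D (p w) φ w, ?_, fun w => ⟨fun a b h => ?_, fun a b c h h' hne => ?_⟩⟩
  · dsimp only
    rw [hD.transport_eq hs (p v) .nil hφ]
    exact hv
  · rw [key _ _ h.adj, key _ _ h.swap_right.adj]
    exact (hD.isGerm_transport (p w) hφ).triangle _ _ h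
  · rw [key _ _ h.adj, key _ _ h.swap_right.adj, key _ _ h'.swap_right.adj]
    exact (hD.isGerm_transport (p w) hφ).flip _ _ _ h h' hne

end UniformComplex

namespace UniformComplex

/-! ### The developing map on balls of interior radius. -/

variable {W : Type*} {D : AbstractSimplicialComplex W}

/-- The reflection rule at `c (k + 1)` is the recurrence of `hexCycle`, so two consecutive values
determine the rest; hence the induction on pairs. -/
theorem CyclicLink.chart_eq {w : W} {c : ZMod 6 → W} (hc : CyclicLink D w 6 c) {φ : W → ℤ × ℤ}
    (hφ : IsChart D w φ) (i : ZMod 6) :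
    φ (c i) = φ w + hexCycle (φ (c 0) - φ w) (φ (c 1) - φ w) i := by
  have hT : ∀ i, IsTriangle D w (c i) (c (i + 1)) := fun i =>
    (hc.triangle_iff _ _).2 ⟨i, .inl ⟨rfl, rfl⟩⟩
  have key : ∀ k : ℕ,
      φ (c k) = φ w + hexCycle (φ (c 0) - φ w) (φ (c 1) - φ w) k ∧
      φ (c (k + 1)) = φ w + hexCycle (φ (c 0) - φ w) (φ (c 1) - φ w) (k + 1) := by
    intro k
    induction k with
    | zero =>
      rw [Nat.cast_zero, zero_add]
      constructor
      · change _ = _ + (φ (c 0) - φ w); abel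
      · change _ = _ + (φ (c 1) - φ w); abel
    | succ k ih =>
      rw [Nat.cast_add_one]
      refine ⟨ih.2, ?_⟩
      have hne : c (k : ZMod 6) ≠ c (k + 1 + 1) := fun h => by
        have := hc.injective h
        rw [add_assoc, left_eq_add] at this
        revert this; decide
      have h1 := hφ.flip _ _ _ (hT k).swap_right (hT (k + 1)) hne
      have h2 := hexCycle_add_one_add (φ (c 0) - φ w) (φ (c 1) - φ w) (k + 1)
      rw [add_sub_cancel_right] at h2
      rw [ih.1, ih.2, ← h2] at h1
      rw [eq_sub_of_add_eq' h1]
      abel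
  have := (key i.val).1
  rwa [ZMod.natCast_zmod_val] at this

theorem IsHexSurface.hexUnit (hD : IsHexSurface D) {φ : W → ℤ × ℤ} {w x : W}
    (hφ : IsChart D w φ) (h : (oneSkeleton D).Adj w x) : HexUnit (φ x - φ w) := by
  obtain ⟨y, hy⟩ := hD.exists_triangle h
  exact (hφ.triangle _ _ hy).1

/-- At an interior vertex a chart is an isomorphism onto the star of a lattice point. -/
theorem CyclicLink.chart_bijective {w : W} {c : ZMod 6 → W} (hc : CyclicLink D w 6 c)
    {φ : W → ℤ × ℤ} (hφ : IsChart D w φ) :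
    (∀ p, HexUnit (p - φ w) → ∃ a, (oneSkeleton D).Adj w a ∧ φ a = p) ∧
    (∀ a b, (oneSkeleton D).Adj w a → (oneSkeleton D).Adj w b → φ a = φ b → a = b) ∧
    (∀ a b, (oneSkeleton D).Adj w a → (oneSkeleton D).Adj w b → HexUnit (φ b - φ a) →
      IsTriangle D w a b) := by
  have hval := hc.chart_eq hφ
  have hT : HexTriangle 0 (φ (c 0) - φ w) (φ (c 1) - φ w) :=
    hexTriangle_iff_sub.1 (hφ.triangle _ _ ((hc.triangle_iff _ _).2 ⟨0, .inl ⟨rfl, rfl⟩⟩))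
  refine ⟨fun p hp => ?_, fun a b ha hb h => ?_, fun a b ha hb h => ?_⟩
  · obtain ⟨i, hi⟩ := exists_hexCycle_eq hT hp
    exact ⟨c i, (hc.adj_iff _).2 ⟨i, rfl⟩, by rw [hval, hi]; abel⟩
  · obtain ⟨i, rfl⟩ := (hc.adj_iff _).1 ha
    obtain ⟨j, rfl⟩ := (hc.adj_iff _).1 hb
    rw [hval i, hval j] at h
    rw [eq_of_hexCycle_eq hT (add_left_cancel h)]
  · obtain ⟨i, rfl⟩ := (hc.adj_iff _).1 ha
    obtain ⟨j, rfl⟩ := (hc.adj_iff _).1 hb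
    rw [hval i, hval j, add_sub_add_left_eq_sub] at h
    rcases hexCycle_adj hT h with rfl | rfl
    · exact (hc.triangle_iff _ _).2 ⟨_, .inl ⟨rfl, rfl⟩⟩
    · exact (hc.triangle_iff _ _).2 ⟨_, .inr ⟨rfl, rfl⟩⟩

/-- `dev` is an isometry from the ball of radius `k` about `v` onto that of the lattice. -/
structure DevelopsBall (D : AbstractSimplicialComplex W) (v : W) (dev : W → ℤ × ℤ) (k : ℕ) :
    Prop where
  norm : ∀ x, (oneSkeleton D).dist v x ≤ k → hexNorm (dev x) = (oneSkeleton D).dist v x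
  injective : ∀ x y, (oneSkeleton D).dist v x ≤ k → (oneSkeleton D).dist v y ≤ k →
    dev x = dev y → x = y
  surjective : ∀ p, hexNorm p ≤ k → ∃ x, (oneSkeleton D).dist v x ≤ k ∧ dev x = p

theorem dist_le_of_adj {v x y : W} (hconn : (oneSkeleton D).Connected)
    (h : (oneSkeleton D).Adj x y) :
    (oneSkeleton D).dist v y ≤ (oneSkeleton D).dist v x + 1 := by
  have := hconn.dist_triangle (u := v) (v := x) (w := y)
  rwa [SimpleGraph.dist_eq_one_iff_adj.2 h] at this

theorem exists_adj_dist_eq {v x : W} (hconn : (oneSkeleton D).Connected) {k : ℕ}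
    (h : (oneSkeleton D).dist v x = k + 1) :
    ∃ y, (oneSkeleton D).Adj y x ∧ (oneSkeleton D).dist v y = k := by
  obtain ⟨p, hp⟩ := hconn.exists_walk_length_eq_dist x v
  rw [SimpleGraph.dist_comm, h] at hp
  cases p with
  | nil => simp at hp
  | cons hadj q =>
    rename_i y
    refine ⟨y, hadj.symm, ?_⟩
    have h1 := SimpleGraph.dist_le q
    rw [SimpleGraph.dist_comm] at h1
    have h2 := dist_le_of_adj (v := v) hconn hadj.symm
    simp only [SimpleGraph.Walk.length_cons] at hp
    omega

section Development

variable {v : W} {n : ℕ} {dev : W → ℤ × ℤ}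

theorem DevelopsBall.adj (hD : IsHexSurface D) (hconn : (oneSkeleton D).Connected)
    (hdev : ∀ w, IsChart D w dev)
    (hn : ∀ w : W, (oneSkeleton D).dist v w < n → IsInterior D w) {k : ℕ} (hk : k ≤ n)
    (hB : DevelopsBall D v dev k) {x y : W} (hx : (oneSkeleton D).dist v x ≤ k)
    (hy : (oneSkeleton D).dist v y ≤ k) (h : HexUnit (dev y - dev x)) :
    (oneSkeleton D).Adj x y := by
  have lower : ∀ x y, (oneSkeleton D).dist v x < k → (oneSkeleton D).dist v y ≤ k →
      HexUnit (dev y - dev x) → (oneSkeleton D).Adj x y := by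
    intro x y hx hy h
    obtain ⟨c, hc⟩ := hD.exists_cyclicLink (hn x (by omega))
    obtain ⟨a, ha, hay⟩ := (hc.chart_bijective (hdev x)).1 _ h
    have := dist_le_of_adj (v := v) hconn ha
    rwa [← hB.injective a y (by omega) hy hay]
  rcases hx.lt_or_eq with hx' | hx'
  · exact lower x y hx' hy h
  rcases hy.lt_or_eq with hy' | hy'
  · exact (lower y x hy' hx h.sub_comm).symm
  -- With both ends at distance `k`, neither need be interior when `k = n`. The edge is then found
  -- in the star of a common neighbour `z` one layer below, which is interior.
  cases k with
  | zero =>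
    refine absurd ?_ h.ne
    rw [hexNorm_eq_zero ((hB.norm x hx).trans hx'), hexNorm_eq_zero ((hB.norm y hy).trans hy')]
  | succ k =>
    obtain ⟨r, hr1, hr2, hr⟩ := exists_common_hexNorm_pred h ((hB.norm x hx).trans hx')
      ((hB.norm y hy).trans hy')
    obtain ⟨z, hz, rfl⟩ := hB.surjective r (by omega)
    have hzd := hB.norm z hz
    have h1 := lower z x (by omega) hx hr1
    have h2 := lower z y (by omega) hy hr2
    obtain ⟨c, hc⟩ := hD.exists_cyclicLink (hn z (by omega))
    exact ((hc.chart_bijective (hdev z)).2.2 _ _ h1 h2 h).rotate.adj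

/-- Every vertex of the new layer has a neighbour in the old ball, where all vertices are interior
and have stars mapped bijectively to lattice stars. Local bijectivity there yields all three
properties. -/
theorem DevelopsBall.succ (hD : IsHexSurface D) (hconn : (oneSkeleton D).Connected)
    (hdev : ∀ w, IsChart D w dev)
    (hn : ∀ w : W, (oneSkeleton D).dist v w < n → IsInterior D w) {k : ℕ} (hk : k + 1 ≤ n)
    (hB : DevelopsBall D v dev k) : DevelopsBall D v dev (k + 1) := by
  have hloc : ∀ x, (oneSkeleton D).dist v x ≤ k → ∃ c, CyclicLink D x 6 c := fun x hx =>
    hD.exists_cyclicLink (hn x (by omega))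
  have hadj : ∀ x y, (oneSkeleton D).dist v x ≤ k → (oneSkeleton D).dist v y ≤ k →
      HexUnit (dev y - dev x) → (oneSkeleton D).Adj x y := fun x y hx hy h =>
    hB.adj hD hconn hdev hn (by omega) hx hy h
  have hnorm : ∀ x, (oneSkeleton D).dist v x = k + 1 → hexNorm (dev x) = k + 1 := by
    intro x hx
    obtain ⟨x', hx', hxd⟩ := exists_adj_dist_eq hconn hx
    have hunit := hD.hexUnit (hdev x') hx'
    have h1 := hexNorm_le_add_one hunit
    rw [hB.norm x' hxd.le, hxd] at h1
    -- If `dev x` had norm at most `k`, it would be the image of some `z` in the old ball. Both `z`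
    -- and `x` would be neighbours of `x'` with the same image, hence equal, contradicting the
    -- distance of `x`.
    by_contra hne
    obtain ⟨z, hz, hzx⟩ := hB.surjective (dev x) (by omega)
    rw [← hzx] at hunit
    obtain ⟨c, hc⟩ := hloc x' hxd.le
    have := (hc.chart_bijective (hdev x')).2.1 _ _ (hadj _ _ hxd.le hz hunit) hx' hzx
    subst this
    omega
  have hnorm' : ∀ x, (oneSkeleton D).dist v x ≤ k + 1 →
      hexNorm (dev x) = (oneSkeleton D).dist v x := by
    intro x hx
    rcases Nat.le_succ_iff.1 hx with hx | hx
    · exact hB.norm x hx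
    · rw [hnorm x hx, hx]
  refine ⟨hnorm', fun x y hx hy hxy => ?_, fun p hp => ?_⟩
  · have hd : (oneSkeleton D).dist v x = (oneSkeleton D).dist v y := by
      rw [← hnorm' x hx, ← hnorm' y hy, hxy]
    rcases Nat.le_succ_iff.1 hx with hx | hx
    · exact hB.injective x y hx (by omega) hxy
    · obtain ⟨x', hx', hxd⟩ := exists_adj_dist_eq hconn hx
      obtain ⟨y', hy', hyd⟩ := exists_adj_dist_eq hconn (hd.symm.trans hx)
      obtain ⟨c, hc⟩ := hloc x' hxd.le
      obtain ⟨-, hinj, htri⟩ := hc.chart_bijective (hdev x')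
      by_cases hd' : dev x' = dev y'
      · obtain rfl := hB.injective _ _ hxd.le hyd.le hd'
        exact hinj _ _ hx' hy' hxy
      -- Here `dev x'` and `dev y'` are distinct predecessors of one lattice point, hence adjacent.
      -- Thus `x'`, `y'`, `x` span a triangle, so `x` and `y` are neighbours of `y'` with the same
      -- image.
      · have hux := hD.hexUnit (hdev x') hx'
        have huy := hD.hexUnit (hdev y') hy'
        rw [← hxy] at huy
        have hxy' := hadj _ _ hxd.le hyd.le (hexUnit_of_hexNorm_pred hux huy hd' (hnorm x hx)
          ((hB.norm _ hxd.le).trans hxd) ((hB.norm _ hyd.le).trans hyd))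
        have htri' := htri _ _ hxy' hx' huy
        obtain ⟨c', hc'⟩ := hloc y' hyd.le
        exact (hc'.chart_bijective (hdev y')).2.1 _ _ htri'.rotate.adj hy' hxy
  · rcases Nat.le_succ_iff.1 hp with hp | hp
    · obtain ⟨x, hx, h⟩ := hB.surjective p hp
      exact ⟨x, by omega, h⟩
    · obtain ⟨q, hq, hqk⟩ := exists_hexNorm_pred hp
      obtain ⟨z, hz, rfl⟩ := hB.surjective q hqk.le
      obtain ⟨c, hc⟩ := hloc z hz
      obtain ⟨a, ha, hap⟩ := (hc.chart_bijective (hdev z)).1 _ hq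
      have := dist_le_of_adj (v := v) hconn ha
      exact ⟨a, by omega, hap⟩

theorem IsHexSurface.developsBall (hD : IsHexSurface D) (hconn : (oneSkeleton D).Connected)
    (hdev : ∀ w, IsChart D w dev) (hv : dev v = 0)
    (hn : ∀ w : W, (oneSkeleton D).dist v w < n → IsInterior D w) {k : ℕ} (hk : k ≤ n) :
    DevelopsBall D v dev k := by
  induction k with
  | zero =>
    have h0 : ∀ x, (oneSkeleton D).dist v x ≤ 0 → x = v := fun x hx =>
      (hconn.dist_eq_zero_iff.1 (Nat.le_zero.1 hx)).symm
    refine ⟨fun x hx => ?_, fun x y hx hy _ => (h0 x hx).trans (h0 y hy).symm, fun p hp => ?_⟩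
    · rw [h0 x hx, hv, SimpleGraph.dist_self]; rfl
    · exact ⟨v, by simp, by rw [hv, hexNorm_eq_zero (Nat.le_zero.1 hp)]⟩
  | succ k ih => exact (ih (by omega)).succ hD hconn hdev hn hk

end Development

end UniformComplex

namespace UniformComplex

/-! ### Counting edges and triangles of a lattice hexagon. -/

/-- The edges of the hexagon of radius `n`. -/
def hexSphere (n : ℕ) : Set (Finset (ℤ × ℤ)) :=
  {s | ∃ p q, HexUnit (q - p) ∧ hexNorm p = n ∧ hexNorm q = n ∧ s = {p, q}}

/-- The lattice triangles inside the hexagon of radius `n`. -/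
def hexBall (n : ℕ) : Set (Finset (ℤ × ℤ)) :=
  {s | ∃ p q r, HexTriangle p q r ∧ hexNorm p ≤ n ∧ hexNorm q ≤ n ∧ hexNorm r ≤ n ∧
    s = {p, q, r}}

/-- The direction of a side of a hexagon, in counterclockwise order. -/
def sideDir : Fin 6 → ℤ × ℤ
  | 0 => (-1, 1)
  | 1 => (-1, 0)
  | 2 => (0, -1)
  | 3 => (1, -1)
  | 4 => (1, 0)
  | 5 => (0, 1)

/-- The `j`-th point on a side of the hexagon of radius `n`. -/
def sidePoint (n : ℤ) : Fin 6 → ℤ → ℤ × ℤ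
  | 0, j => (n - j, j)
  | 1, j => (-j, n)
  | 2, j => (-n, n - j)
  | 3, j => (j - n, -j)
  | 4, j => (j, -n)
  | 5, j => (n, j - n)

theorem exists_sidePoint {n : ℕ} {p q : ℤ × ℤ} (h : HexUnit (q - p)) (hp : hexNorm p = n)
    (hq : hexNorm q = n) : ∃ i : Fin 6, ∃ j : ℤ, 0 ≤ j ∧ j < n ∧
      ((p = sidePoint n i j ∧ q = sidePoint n i j + sideDir i) ∨
        (q = sidePoint n i j ∧ p = sidePoint n i j + sideDir i)) := by
  obtain ⟨d, rfl⟩ : ∃ d, q = p + d := ⟨q - p, by abel⟩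
  rw [add_sub_cancel_left] at h
  have hs := hexNorm_side h hp hq
  obtain ⟨a, b⟩ := p
  rw [hexNorm_eq_iff] at hp hq
  replace hp := hp.1
  replace hq := hq.1
  simp only [Prod.fst_add, Prod.snd_add] at hs hp hq
  rcases h with rfl | rfl | rfl | rfl | rfl | rfl
  · rcases (by simpa using hs : b = n ∨ b = -(n : ℤ)) with h | h
    · refine ⟨1, -(a + 1), by omega, by omega, .inr ?_⟩
      simp [sidePoint, sideDir]; omega
    · refine ⟨4, a, by omega, by omega, .inl ?_⟩
      simp [sidePoint, sideDir]; omega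
  · rcases (by simpa using hs : a = n ∨ a = -(n : ℤ)) with h | h
    · refine ⟨5, b + n, by omega, by omega, .inl ?_⟩
      simp [sidePoint, sideDir]; omega
    · refine ⟨2, n - b - 1, by omega, by omega, .inr ?_⟩
      simp [sidePoint, sideDir]; omega
  · rcases (by simpa using hs : a + b = n ∨ a + b = -(n : ℤ)) with h | h
    · refine ⟨0, b, by omega, by omega, .inl ?_⟩
      simp [sidePoint, sideDir]; omega
    · refine ⟨3, -b - 1, by omega, by omega, .inr ?_⟩
      simp [sidePoint, sideDir]; omega
  · rcases (by simpa using hs : b = n ∨ b = -(n : ℤ)) with h | h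
    · refine ⟨1, -a, by omega, by omega, .inl ?_⟩
      simp [sidePoint, sideDir]; omega
    · refine ⟨4, a - 1, by omega, by omega, .inr ?_⟩
      simp [sidePoint, sideDir]; omega
  · rcases (by simpa using hs : a = n ∨ a = -(n : ℤ)) with h | h
    · refine ⟨5, b + n - 1, by omega, by omega, .inr ?_⟩
      simp [sidePoint, sideDir]; omega
    · refine ⟨2, n - b, by omega, by omega, .inl ?_⟩
      simp [sidePoint, sideDir]; omega
  · rcases (by simpa using hs : a + b = n ∨ a + b = -(n : ℤ)) with h | h
    · refine ⟨0, b - 1, by omega, by omega, .inr ?_⟩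
      simp [sidePoint, sideDir]; omega
    · refine ⟨3, -b, by omega, by omega, .inl ?_⟩
      simp [sidePoint, sideDir]; omega

theorem hexUnit_sideDir (i : Fin 6) : HexUnit (sideDir i) := by
  revert i; decide

theorem hexNorm_sidePoint {n : ℕ} (i : Fin 6) {j : ℤ} (h0 : 0 ≤ j) (hj : j < n) :
    hexNorm (sidePoint n i j) = n ∧ hexNorm (sidePoint n i j + sideDir i) = n := by
  rw [hexNorm_eq_iff, hexNorm_eq_iff]
  fin_cases i <;> simp [sidePoint, sideDir] <;> omega

/-- Twice the midpoint of an edge does not depend on the order of its ends, so it separates edges as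
unordered pairs. -/
theorem sidePoint_midpoint_injective {n : ℤ} {i i' : Fin 6} {j j' : ℤ} (h0 : 0 ≤ j) (hj : j < n)
    (h0' : 0 ≤ j') (hj' : j' < n)
    (h : sidePoint n i j + (sidePoint n i j + sideDir i) =
      sidePoint n i' j' + (sidePoint n i' j' + sideDir i')) : i = i' ∧ j = j' := by
  fin_cases i <;> fin_cases i' <;> simp [sidePoint, sideDir] at h ⊢ <;> omega

theorem ncard_hexSphere (n : ℕ) : (hexSphere n).ncard = 6 * n := by
  let E : Fin 6 × ℕ → Finset (ℤ × ℤ) := fun x =>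
    {sidePoint n x.1 x.2, sidePoint n x.1 x.2 + sideDir x.1}
  have hsum : ∀ x, ∑ p ∈ E x, p = sidePoint n x.1 x.2 + (sidePoint n x.1 x.2 + sideDir x.1) :=
    fun x => Finset.sum_pair (HexUnit.ne (by simpa using hexUnit_sideDir x.1))
  have himage : hexSphere n = E '' ((Finset.univ ×ˢ Finset.range n : Finset (Fin 6 × ℕ)) :
      Set (Fin 6 × ℕ)) := by
    ext s
    constructor
    · rintro ⟨p, q, h, hp, hq, rfl⟩
      obtain ⟨i, j, h0, hj, hpq⟩ := exists_sidePoint h hp hq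
      lift j to ℕ using h0
      refine ⟨(i, j), by simpa using hj, ?_⟩
      rcases hpq with ⟨rfl, rfl⟩ | ⟨rfl, rfl⟩
      · rfl
      · exact Finset.pair_comm _ _
    · rintro ⟨⟨i, j⟩, hij, rfl⟩
      have hj : (j : ℤ) < n := by simpa using hij
      obtain ⟨h1, h2⟩ := hexNorm_sidePoint i (Int.natCast_nonneg j) hj
      exact ⟨_, _, by simpa using hexUnit_sideDir i, h1, h2, rfl⟩
  rw [himage, Set.InjOn.ncard_image, Set.ncard_coe_finset, Finset.card_product]
  · simp
  · rintro ⟨i, j⟩ hij ⟨i', j'⟩ hij' h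
    have h := congrArg (fun s => ∑ p ∈ s, p) h
    simp only [hsum] at h
    have hj : (j : ℤ) < n := by simpa using hij
    have hj' : (j' : ℤ) < n := by simpa using hij'
    obtain ⟨rfl, h'⟩ := sidePoint_midpoint_injective (by omega) hj (by omega) hj' h
    rw [Nat.cast_inj.1 h']

/-- The triangle with corners `p`, `p + 1`, `p + exp (iπ/3)`, or its reflection in the origin. -/
def latticeTriangle : Bool → ℤ × ℤ → Finset (ℤ × ℤ)
  | true, p => {p, p + (1, 0), p + (0, 1)}
  | false, p => {-p, -p + (-1, 0), -p + (0, -1)}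

theorem sum_triple {p d e : ℤ × ℤ} (hd : d ≠ 0) (he : e ≠ 0) (hde : d ≠ e) :
    ∑ x ∈ ({p, p + d, p + e} : Finset (ℤ × ℤ)), x = p + (p + d + (p + e)) := by
  rw [Finset.sum_insert (by simpa using ⟨hd, he⟩), Finset.sum_pair (by simpa using hde)]

theorem sum_latticeTriangle (b : Bool) (p : ℤ × ℤ) : ∑ x ∈ latticeTriangle b p, x =
    if b then (3 * p.1 + 1, 3 * p.2 + 1) else (-(3 * p.1 + 1), -(3 * p.2 + 1)) := by
  cases b
  · rw [latticeTriangle, sum_triple (by decide) (by decide) (by decide)]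
    ext <;> simp <;> ring
  · rw [latticeTriangle, sum_triple (by decide) (by decide) (by decide)]
    ext <;> simp <;> ring

/-- The coordinates of the sum of the vertices are 1 modulo 3 for one orientation and -1 for the
other; the sum then gives the base point. -/
theorem latticeTriangle_injective {b b' : Bool} {p p' : ℤ × ℤ}
    (h : latticeTriangle b p = latticeTriangle b' p') : b = b' ∧ p = p' := by
  have h := congrArg (fun s => ∑ x ∈ s, x) h
  simp only [sum_latticeTriangle] at h
  rw [Prod.ext_iff] at h ⊢
  cases b <;> cases b' <;> simp at h ⊢ <;> omega

set_option linter.unusedSimpArgs false in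
theorem HexTriangle.exists_latticeTriangle {p q r : ℤ × ℤ} (h : HexTriangle p q r) :
    ∃ b c, ({p, q, r} : Finset (ℤ × ℤ)) = latticeTriangle b c := by
  have key : ∀ {p q r : ℤ × ℤ}, HexTriangle p q r →
      (r - p = (0, 1) ∧ q - p = (1, 0)) ∨ (r - p = (0, -1) ∧ q - p = (-1, 0)) →
      ∃ b c, ({p, q, r} : Finset (ℤ × ℤ)) = latticeTriangle b c := by
    rintro p q r - (⟨h1, h2⟩ | ⟨h1, h2⟩)
    · exact ⟨true, p, by rw [latticeTriangle, ← h1, ← h2, add_sub_cancel, add_sub_cancel]⟩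
    · exact ⟨false, -p, by
        rw [latticeTriangle, neg_neg, ← h1, ← h2, add_sub_cancel, add_sub_cancel]⟩
  have perm1 : ({p, q, r} : Finset (ℤ × ℤ)) = {q, p, r} := Finset.insert_comm _ _ _
  have perm2 : ∀ {p q r : ℤ × ℤ}, ({p, q, r} : Finset (ℤ × ℤ)) = {p, r, q} := fun {p q r} => by
    rw [Finset.pair_comm]
  have perm3 : ({p, q, r} : Finset (ℤ × ℤ)) = {r, p, q} := by
    rw [perm2, Finset.insert_comm]
  have hh := h
  obtain ⟨d, e, rfl, rfl, hde⟩ := h.cases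
  simp only [Prod.mk.injEq] at hde
  rcases hde with ⟨rfl, rfl⟩ | ⟨rfl, rfl⟩ | ⟨rfl, rfl⟩ | ⟨rfl, rfl⟩ | ⟨rfl, rfl⟩ | ⟨rfl, rfl⟩ |
      ⟨rfl, rfl⟩ | ⟨rfl, rfl⟩ | ⟨rfl, rfl⟩ | ⟨rfl, rfl⟩ | ⟨rfl, rfl⟩ | ⟨rfl, rfl⟩ <;>
  -- Some ordering of the three vertices puts the base corner first, followed by its two neighbours
  -- in the required order.
  first
  | exact key hh
      (by simp only [add_sub_add_left_eq_sub, add_sub_cancel_left, sub_add_cancel_left]; decide)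
  | (rw [perm2]; exact key hh.swap_right
      (by simp only [add_sub_add_left_eq_sub, add_sub_cancel_left, sub_add_cancel_left]; decide))
  | (rw [perm1]; exact key hh.swap_left
      (by simp only [add_sub_add_left_eq_sub, add_sub_cancel_left, sub_add_cancel_left]; decide))
  | (rw [perm1, perm2]; exact key hh.swap_left.swap_right
      (by simp only [add_sub_add_left_eq_sub, add_sub_cancel_left, sub_add_cancel_left]; decide))
  | (rw [perm3]; exact key hh.swap_right.swap_left
      (by simp only [add_sub_add_left_eq_sub, add_sub_cancel_left, sub_add_cancel_left]; decide))
  | (rw [perm3, perm2]; exact key hh.swap_right.swap_left.swap_right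
      (by simp only [add_sub_add_left_eq_sub, add_sub_cancel_left, sub_add_cancel_left]; decide))

/-- The three rhombi into which the base points of the triangles of a hexagon are divided. -/
def rhombusPoint : Fin 3 → ℤ → ℤ → ℤ × ℤ
  | 0, x, y => (x, -1 - y)
  | 1, x, y => (y - x, x)
  | 2, x, y => (-1 - y, y - x)

/-- The condition on a base point for its triangles to lie in the hexagon of radius `n`. -/
def IsBasePoint (n : ℤ) (p : ℤ × ℤ) : Prop :=
  -n ≤ p.1 ∧ p.1 < n ∧ -n ≤ p.2 ∧ p.2 < n ∧ -n ≤ p.1 + p.2 ∧ p.1 + p.2 < n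

/-- One condition serves both orientations because the hexagon is symmetric under reflection in the
origin. -/
theorem latticeTriangle_subset_iff {n : ℕ} {b : Bool} {p : ℤ × ℤ} :
    (∀ x ∈ latticeTriangle b p, hexNorm x ≤ n) ↔ IsBasePoint n p := by
  cases b <;> simp [latticeTriangle, hexNorm_le_iff, IsBasePoint] <;> omega

/-- The regions `a ≥ 0 > b`, then `b ≥ 0` with `a + b ≥ 0`, and finally `a < 0` with `a + b < 0` cut
the base points into three `n` by `n` rhombi. With two orientations this gives `2 * 3 * n ^ 2`
triangles. -/
theorem isBasePoint_iff {n : ℤ} {p : ℤ × ℤ} : IsBasePoint n p ↔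
    ∃ i x y, 0 ≤ x ∧ x < n ∧ 0 ≤ y ∧ y < n ∧ p = rhombusPoint i x y := by
  obtain ⟨a, b⟩ := p
  constructor
  · rintro ⟨h1, h2, h3, h4, h5, h6⟩
    dsimp only at *
    by_cases ha : 0 ≤ a ∧ b < 0
    · exact ⟨0, a, -1 - b, by omega, by omega, by omega, by omega, by
        simp [rhombusPoint]⟩
    by_cases hb : 0 ≤ b ∧ 0 ≤ a + b
    · exact ⟨1, b, a + b, by omega, by omega, by omega, by omega, by
        simp [rhombusPoint]⟩
    · exact ⟨2, -1 - a - b, -1 - a, by omega, by omega, by omega, by omega, by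
        simp [rhombusPoint]⟩
  · rintro ⟨i, x, y, hx, hx', hy, hy', h⟩
    rw [Prod.ext_iff] at h
    unfold IsBasePoint
    fin_cases i <;> simp [rhombusPoint] at h <;> dsimp only <;> omega

theorem rhombusPoint_injective {i i' : Fin 3} {x x' y y' : ℤ} (hx : 0 ≤ x) (hx' : 0 ≤ x')
    (hy : 0 ≤ y) (hy' : 0 ≤ y') (h : rhombusPoint i x y = rhombusPoint i' x' y') :
    i = i' ∧ x = x' ∧ y = y' := by
  rw [Prod.ext_iff] at h
  fin_cases i <;> fin_cases i' <;> simp [rhombusPoint] at h ⊢ <;> omega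

theorem hexTriangle_up (p : ℤ × ℤ) : HexTriangle p (p + (1, 0)) (p + (0, 1)) := by
  rw [hexTriangle_iff_sub, add_sub_cancel_left, add_sub_cancel_left]; decide

theorem hexTriangle_down (p : ℤ × ℤ) : HexTriangle p (p + (-1, 0)) (p + (0, -1)) := by
  rw [hexTriangle_iff_sub, add_sub_cancel_left, add_sub_cancel_left]; decide

theorem mem_hexBall_iff {n : ℕ} {s : Finset (ℤ × ℤ)} :
    s ∈ hexBall n ↔ ∃ b p, IsBasePoint n p ∧ s = latticeTriangle b p := by
  constructor
  · rintro ⟨p, q, r, h, hp, hq, hr, rfl⟩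
    obtain ⟨b, c, hbc⟩ := h.exists_latticeTriangle
    refine ⟨b, c, ?_, hbc⟩
    rw [← latticeTriangle_subset_iff (b := b), ← hbc]
    simpa using ⟨hp, hq, hr⟩
  · rintro ⟨b, p, h, rfl⟩
    rw [← latticeTriangle_subset_iff (b := b)] at h
    cases b
    · exact ⟨_, _, _, hexTriangle_down (-p), h _ (by simp [latticeTriangle]),
        h _ (by simp [latticeTriangle]), h _ (by simp [latticeTriangle]), rfl⟩
    · exact ⟨_, _, _, hexTriangle_up p, h _ (by simp [latticeTriangle]),
        h _ (by simp [latticeTriangle]), h _ (by simp [latticeTriangle]), rfl⟩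

theorem ncard_hexBall (n : ℕ) : (hexBall n).ncard = 6 * n ^ 2 := by
  let T : Bool × Fin 3 × ℕ × ℕ → Finset (ℤ × ℤ) := fun x =>
    latticeTriangle x.1 (rhombusPoint x.2.1 x.2.2.1 x.2.2.2)
  have himage : hexBall n = T '' ((Finset.univ ×ˢ Finset.univ ×ˢ Finset.range n ×ˢ Finset.range n :
      Finset (Bool × Fin 3 × ℕ × ℕ)) : Set (Bool × Fin 3 × ℕ × ℕ)) := by
    ext s
    rw [mem_hexBall_iff]
    constructor
    · rintro ⟨b, p, h, rfl⟩
      obtain ⟨i, x, y, hx, hx', hy, hy', rfl⟩ := isBasePoint_iff.1 h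
      lift x to ℕ using hx
      lift y to ℕ using hy
      exact ⟨(b, i, x, y), by simpa using ⟨by omega, by omega⟩, rfl⟩
    · rintro ⟨⟨b, i, x, y⟩, h, rfl⟩
      have h' : x < n ∧ y < n := by simpa using h
      exact ⟨b, _, isBasePoint_iff.2 ⟨i, x, y, by omega, by omega, by omega, by omega, rfl⟩, rfl⟩
  rw [himage, Set.InjOn.ncard_image, Set.ncard_coe_finset]
  · simp only [Finset.card_product, Finset.card_univ, Fintype.card_bool, Fintype.card_fin,
      Finset.card_range]
    ring
  · rintro ⟨b, i, x, y⟩ - ⟨b', i', x', y'⟩ - h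
    obtain ⟨rfl, h⟩ := latticeTriangle_injective h
    obtain ⟨rfl, h1, h2⟩ := rhombusPoint_injective (by simp) (by simp) (by simp) (by simp) h
    dsimp only at h1 h2
    rw [Nat.cast_inj.1 h1, Nat.cast_inj.1 h2]

/-! ### Transfer of the lattice counts to the disc. -/

variable {W : Type*} {D : AbstractSimplicialComplex W} {v : W} {n : ℕ} {dev : W → ℤ × ℤ}

theorem DevelopsBall.image_injOn (hB : DevelopsBall D v dev n) :
    Set.InjOn (fun s : Finset W => s.image dev)
      {s | ∀ x ∈ s, (oneSkeleton D).dist v x ≤ n} := by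
  have hsub : ∀ s t : Finset W, (∀ x ∈ s, (oneSkeleton D).dist v x ≤ n) →
      (∀ x ∈ t, (oneSkeleton D).dist v x ≤ n) → s.image dev = t.image dev → s ⊆ t := by
    intro s t hs ht h x hx
    have hxi := Finset.mem_image_of_mem dev hx
    rw [h, Finset.mem_image] at hxi
    obtain ⟨y, hy, hyx⟩ := hxi
    rwa [← hB.injective y x (ht y hy) (hs x hx) hyx]
  exact fun s hs t ht h => (hsub s t hs ht h).antisymm (hsub t s ht hs h.symm)

theorem DevelopsBall.image_sphere (hD : IsHexSurface D) (hconn : (oneSkeleton D).Connected)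
    (hdev : ∀ w, IsChart D w dev)
    (hn : ∀ w : W, (oneSkeleton D).dist v w < n → IsInterior D w) (hB : DevelopsBall D v dev n) :
    (fun s : Finset W => s.image dev) '' sphere D v n = hexSphere n := by
  classical
  ext s
  constructor
  · rintro ⟨e, ⟨he, h2, hd⟩, rfl⟩
    obtain ⟨x, y, hxy, rfl⟩ := Finset.card_eq_two.1 h2
    have hx := hd x (by simp)
    have hy := hd y (by simp)
    exact ⟨dev x, dev y, hD.hexUnit (hdev x) ⟨hxy, by convert he⟩, (hB.norm x hx.le).trans hx,
      (hB.norm y hy.le).trans hy, by simp⟩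
  · rintro ⟨p, q, h, hp, hq, rfl⟩
    obtain ⟨x, hx, rfl⟩ := hB.surjective p hp.le
    obtain ⟨y, hy, rfl⟩ := hB.surjective q hq.le
    have hadj := hB.adj hD hconn hdev hn le_rfl hx hy h
    refine ⟨{x, y}, ⟨by convert hadj.2, Finset.card_pair hadj.1, ?_⟩, by simp⟩
    simpa using ⟨(hB.norm x hx).symm.trans hp, (hB.norm y hy).symm.trans hq⟩

/-- Some vertex of the triangle is at distance less than `n`, hence interior, and its star reflects
lattice triangles back to triangles of the disc. -/
theorem DevelopsBall.isTriangle (hD : IsHexSurface D) (hconn : (oneSkeleton D).Connected)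
    (hdev : ∀ w, IsChart D w dev)
    (hn : ∀ w : W, (oneSkeleton D).dist v w < n → IsInterior D w) (hB : DevelopsBall D v dev n)
    {x y z : W} (hx : (oneSkeleton D).dist v x ≤ n) (hy : (oneSkeleton D).dist v y ≤ n)
    (hz : (oneSkeleton D).dist v z ≤ n) (h : HexTriangle (dev x) (dev y) (dev z)) :
    IsTriangle D x y z := by
  have key : ∀ x y z, (oneSkeleton D).dist v x < n → (oneSkeleton D).dist v y ≤ n →
      (oneSkeleton D).dist v z ≤ n → HexTriangle (dev x) (dev y) (dev z) →
      IsTriangle D x y z := by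
    intro x y z hx hy hz h
    obtain ⟨c, hc⟩ := hD.exists_cyclicLink (hn x hx)
    exact (hc.chart_bijective (hdev x)).2.2 _ _ (hB.adj hD hconn hdev hn le_rfl hx.le hy h.1)
      (hB.adj hD hconn hdev hn le_rfl hx.le hz h.2.1) h.2.2
  have hlt := h.exists_hexNorm_lt (n := n) ((hB.norm x hx).trans_le hx)
    ((hB.norm y hy).trans_le hy) ((hB.norm z hz).trans_le hz)
  rw [hB.norm x hx, hB.norm y hy, hB.norm z hz] at hlt
  rcases hlt with hlt | hlt | hlt
  · exact key x y z hlt hy hz h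
  · exact (key y x z hlt hx hz h.swap_left).swap_left
  · exact (key z x y hlt hx hy h.swap_right.swap_left).rotate

theorem DevelopsBall.image_ball (hD : IsHexSurface D) (hconn : (oneSkeleton D).Connected)
    (hdev : ∀ w, IsChart D w dev)
    (hn : ∀ w : W, (oneSkeleton D).dist v w < n → IsInterior D w) (hB : DevelopsBall D v dev n) :
    (fun s : Finset W => s.image dev) ''
      {s | s ∈ triangles D ∧ ∀ w ∈ s, (oneSkeleton D).dist v w ≤ n} = hexBall n := by
  classical
  ext s
  constructor
  · rintro ⟨t, ⟨⟨ht, h3⟩, hd⟩, rfl⟩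
    obtain ⟨x, y, z, hxy, hxz, hyz, rfl⟩ := Finset.card_eq_three.1 h3
    have hx := hd x (by simp)
    have hy := hd y (by simp)
    have hz := hd z (by simp)
    exact ⟨dev x, dev y, dev z, (hdev x).triangle _ _ ⟨hxy, hxz, hyz, by convert ht⟩,
      (hB.norm x hx).trans_le hx, (hB.norm y hy).trans_le hy, (hB.norm z hz).trans_le hz,
      by simp [Finset.image_insert]⟩
  · rintro ⟨p, q, r, h, hp, hq, hr, rfl⟩
    obtain ⟨x, hx, rfl⟩ := hB.surjective p hp
    obtain ⟨y, hy, rfl⟩ := hB.surjective q hq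
    obtain ⟨z, hz, rfl⟩ := hB.surjective r hr
    obtain ⟨hxy, hxz, hyz, hf⟩ := hB.isTriangle hD hconn hdev hn hx hy hz h
    refine ⟨{x, y, z}, ⟨⟨by convert hf, Finset.card_eq_three.2 ⟨x, y, z, hxy, hxz, hyz, rfl⟩⟩, ?_⟩,
      by simp [Finset.image_insert]⟩
    simpa using ⟨hx, hy, hz⟩

/-- Spheres and balls in a disc whose interior vertices have degree `6`. -/
theorem IsDisc.sphereLength_and_sphereArea (hdisc : IsDisc D)
    (h6 : ∀ w, IsInterior D w → ((oneSkeleton D).neighborSet w).ncard = 6)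
    (hn : ∀ w : W, (oneSkeleton D).dist v w < n → IsInterior D w) :
    sphereLength D v n = 6 * n ∧ sphereArea D v n = 6 * n ^ 2 := by
  have hD := hdisc.isHexSurface h6
  have hconn := hdisc.simplyConnected.connected
  obtain ⟨dev, hv, hdev⟩ := hD.exists_development hdisc.simplyConnected v
  have hB := hD.developsBall hconn hdev hv hn le_rfl
  constructor
  · rw [sphereLength, ← ncard_hexSphere, ← hB.image_sphere hD hconn hdev hn]
    exact (hB.image_injOn.mono (fun e he w hw => (he.2.2 w hw).le)).ncard_image.symm
  · rw [sphereArea, ← ncard_hexBall, ← hB.image_ball hD hconn hdev hn]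
    exact (hB.image_injOn.mono (fun t ht => ht.2)).ncard_image.symm

end UniformComplex

/-- `hn` says that the sphere of radius `n` lies inside the disc `D`: every vertex at distance less
than `n` from `v` (in particular `v` itself, if `n ≥ 1`) is an interior vertex of `D`. -/
theorem theorem3p5 {V : Type*} (X : AbstractSimplicialComplex V)
    (hX : UniformComplex.IsUniform 6 X)
    (γ : PreAbstractSimplicialComplex V) (hγ : UniformComplex.IsLoop X γ)
    {W : Type} (D : AbstractSimplicialComplex W) (f : W → V)
    (hD : UniformComplex.IsMinimalFillingDiagram X γ D f) (v : W) (n : ℕ)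
    (hn : ∀ w : W, (UniformComplex.oneSkeleton D).dist v w < n → UniformComplex.IsInterior D w) :
    UniformComplex.sphereLength D v n = 6 * n ∧
      (UniformComplex.sphereArea D v n : ℚ) = (UniformComplex.sphereLength D v n : ℚ) ^ 2 / 6 := by
  obtain ⟨h1, h2⟩ := hD.1.disc.sphereLength_and_sphereArea
    (hX.neighbours γ hγ W D f hD) hn
  refine ⟨h1, ?_⟩
  rw [h1, h2]
  push_cast
  ring
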